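/- Fix $\tau\in(2,3)$ and $C>0$, and put $\alpha=1/(\tau-1)$. Let $F$ be the distribution function with $1-F(x)=Cx^{-(\tau-1)}$ for $x\ge C^{\alpha}$ (and $F=0$ below $C^\alpha$), and let $w_i=[1-F]^{-1}(i/n)$ for $i\in[n]=\{1,\dots,n\}$, so that $n^{-\alpha}w_i=c_F\,i^{-\alpha}$ with $c_F=C^{\alpha}$. Let $\mathrm{NR}_n(w)$ be the Norros–Reittu random graph on $[n]$: the pairs $\{i,j\}$, $i\ne j$, are edges independently with probability $p_{ij}=1-e^{-w_iw_j/\ell_n}$, where $\ell_n=\sum_{k\in[n]}w_k$. For $\pi\in[0,1]$ let $\mathrm{NR}_n(w,\pi)$ be obtained from it by keeping each edge independently with probability $\pi$. Let $\mathscr C_{(1)}(\pi),\mathscr C_{(2)}(\pi),\dots$ be the connected components of $\mathrm{NR}_n(w,\pi)$ in non-increasing order of their sizes (numbers of vertices), ties being broken arbitrarily, with $\mathscr C_{(i)}(\pi)=\varnothing$ if there are fewer than $i$ components, and let $W_{(i)}(\pi)=\sum_{v\in\mathscr C_{(i)}(\pi)}w_v$. **Theorem.** Let $\pi_n\in[0,1]$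 satisfy $\pi_n=\lambda_n n^{-(3-\tau)/2}$ for all large $n$, with $\lambda_n\to0$, and suppose that $\pi_n\gg n^{-\alpha}$, i.e. $n^{-\alpha}/\pi_n\to0$. Then for each fixed $i\ge1$, as $n\to\infty$, $$\frac{|\mathscr C_{(i)}(\pi_n)|}{n^{\alpha}\pi_n}\xrightarrow{\ \mathbb P\ }c_F\,i^{-\alpha}\qquad\text{and}\qquad\frac{W_{(i)}(\pi_n)}{n^{\alpha}}\xrightarrow{\ \mathbb P\ }c_F\,i^{-\alpha}.$$ Moreover, the largest clusters are essentially the stars of the hubs, which lie in distinct components: for each fixed $i\ge1$, - with probability tending to $1$, vertex $i$ (the vertex of $i$-th largest weight) belongs to $\mathscr C_{(i)}(\pi_n)$; - the number of vertices of $\mathscr C_{(i)}(\pi_n)$ that are neither vertex $i$ nor a neighbour of $i$ in $\mathrm{NR}_n(w,\pi_n)$, divided by $n^{\alpha}\pi_n$, tends to $0$ in probability; - for each fixed $j\ge1$ with $j\ne i$, with probability tending to $1$ the vertices $i$ and $j$ lie in different components of $\mathrm{NR}_n(w,\pi_n)$. -/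

import Mathlib

open MeasureTheory ProbabilityTheory Filter Topology Asymptotics

namespace NorrosReittu

noncomputable section

/-! ### Scale-free weights -/

/-- The distribution function `F` with `1 - F(x) = C x^{-(τ-1)}` on its support
`[C^{1/(τ-1)}, ∞)`, and `F = 0` to the left of the support. -/
def powerCDF (τ C x : ℝ) : ℝ :=
  if C ^ (1 / (τ - 1)) ≤ x then 1 - C * x ^ (-(τ - 1)) else 0

/-- The inverse of `1 - F` on the support of `F`. -/
def tailInv (τ C u : ℝ) : ℝ :=
  sInf {x : ℝ | C ^ (1 / (τ - 1)) ≤ x ∧ 1 - powerCDF τ C x ≤ u}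

/-- The weight `w_i = [1 - F]⁻¹(i / n)` of the vertex with label `i ∈ {1, …, n}`. -/
def weight (τ C : ℝ) (n i : ℕ) : ℝ := tailInv τ C ((i : ℝ) / n)

/-- The exponent `α = 1 / (τ - 1)`. -/
def alpha (τ : ℝ) : ℝ := 1 / (τ - 1)

/-- The constant `c_F` such that `n^{-α} w_i = c_F i^{-α}`; see `weight_scaling`. -/
def cF (τ C : ℝ) : ℝ := C ^ alpha τ

theorem tailInv_eq {τ C u : ℝ} (hτ : 1 < τ) (hC : 0 < C) (hu : 0 < u) (hu1 : u ≤ 1) :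
    tailInv τ C u = cF τ C * u ^ (-alpha τ) := by
  have ht : 0 < τ - 1 := by linarith
  have ha : 0 < alpha τ := by unfold alpha; positivity
  have hc : 0 < cF τ C := Real.rpow_pos_of_pos hC _
  have hua : 1 ≤ u ^ (-alpha τ) :=
    Real.one_le_rpow_of_pos_of_le_one_of_nonpos hu hu1 (by linarith)
  have key : ∀ x : ℝ, 0 < x → (C * x ^ (-(τ - 1)) ≤ u ↔ cF τ C * u ^ (-alpha τ) ≤ x) := by
    intro x hx
    have h1 : C * x ^ (-(τ - 1)) ≤ u ↔ C * u⁻¹ ≤ x ^ (τ - 1) := by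
      rw [Real.rpow_neg hx.le, ← div_eq_mul_inv, ← div_eq_mul_inv,
        div_le_iff₀ (Real.rpow_pos_of_pos hx _), div_le_iff₀ hu, mul_comm]
    have h2 : cF τ C * u ^ (-alpha τ) = (C * u⁻¹) ^ (alpha τ) := by
      rw [Real.mul_rpow hC.le (inv_pos.2 hu).le, Real.inv_rpow hu.le, ← Real.rpow_neg hu.le]
      rfl
    have h3 : x = (x ^ (τ - 1)) ^ (alpha τ) := by
      rw [← Real.rpow_mul hx.le, alpha, mul_one_div_cancel ht.ne', Real.rpow_one]
    rw [h1, h2]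
    conv_rhs => rw [h3]
    exact (Real.rpow_le_rpow_iff (by positivity) (by positivity) ha).symm
  have hset : {x : ℝ | C ^ (1 / (τ - 1)) ≤ x ∧ 1 - powerCDF τ C x ≤ u}
      = Set.Ici (cF τ C * u ^ (-alpha τ)) := by
    ext x
    simp only [Set.mem_ofPred_eq, Set.mem_Ici]
    constructor
    · rintro ⟨h1, h2⟩
      have hx : 0 < x := lt_of_lt_of_le hc h1
      rw [powerCDF, if_pos h1, sub_sub_cancel] at h2
      exact (key x hx).1 h2
    · intro h
      have h1 : C ^ (1 / (τ - 1)) ≤ x := le_trans (le_mul_of_one_le_right hc.le hua) h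
      refine ⟨h1, ?_⟩
      rw [powerCDF, if_pos h1, sub_sub_cancel]
      exact (key x (lt_of_lt_of_le hc h1)).2 h
  rw [tailInv, hset, csInf_Ici]

/-- `n^{-α} w_i = c_F i^{-α}` for all `i ∈ {1, …, n}`. -/
theorem weight_scaling {τ C : ℝ} (hτ : 1 < τ) (hC : 0 < C) {n i : ℕ} (hi : 1 ≤ i) (hin : i ≤ n) :
    (n : ℝ) ^ (-alpha τ) * weight τ C n i = cF τ C * (i : ℝ) ^ (-alpha τ) := by
  have hi0 : (0 : ℝ) < i := by exact_mod_cast hi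
  have hn0 : (0 : ℝ) < n := by exact_mod_cast (lt_of_lt_of_le hi hin)
  have hle : (i : ℝ) / n ≤ 1 := by
    rw [div_le_one hn0]; exact_mod_cast hin
  rw [weight, tailInv_eq hτ hC (by positivity) hle, Real.div_rpow hi0.le hn0.le]
  have : (n : ℝ) ^ (-alpha τ) ≠ 0 := (Real.rpow_pos_of_pos hn0 _).ne'
  field_simp

/-! ### The Norros-Reittu random graph and its percolation

The vertex set `[n]` is `Fin n`; the vertex `v : Fin n` carries the label `v + 1`. -/

/-- The edge probability `p_{ij} = 1 - exp(-w_i w_j / ℓ_n)`, `ℓ_n = ∑_i w_i`, as a function of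
the unordered pair `{i, j}`. (For nonnegative weights the projection to `[0,1]` does nothing.) -/
def edgeProb {n : ℕ} (w : Fin n → ℝ) : Sym2 (Fin n) → unitInterval :=
  Sym2.lift ⟨fun i j => Set.projIcc 0 1 zero_le_one (1 - Real.exp (-(w i * w j / ∑ k, w k))),
    fun i j => by simp only [mul_comm]⟩

/-- A joint realization: the first component says which pairs are edges of the Norros-Reittu graph,
the second one which pairs are retained by percolation. Diagonal pairs play no role. -/
abbrev Config (n : ℕ) : Type := (Sym2 (Fin n) → Bool) × (Sym2 (Fin n) → Bool)

/-- The joint law: all coordinates are independent, the pair `e` is an edge with probability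
`edgeProb w e`, and it is retained with probability `p`. -/
def law {n : ℕ} (w : Fin n → ℝ) (p : unitInterval) : Measure (Config n) :=
  (Measure.pi fun e => bernoulliMeasure true false (edgeProb w e)).prod
    (Measure.pi fun _ => bernoulliMeasure true false p)

/-- The Norros-Reittu graph `NR_n(w)`. -/
def nrGraph {n : ℕ} (ω : Config n) : SimpleGraph (Fin n) :=
  SimpleGraph.fromEdgeSet {e | ω.1 e = true}

/-- The percolated graph `NR_n(w, π)`: the retained edges of `NR_n(w)`. -/
def percGraph {n : ℕ} (ω : Config n) : SimpleGraph (Fin n) :=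
  SimpleGraph.fromEdgeSet {e | e ∈ (nrGraph ω).edgeSet ∧ ω.2 e = true}

/-! ### Ordered components -/

/-- An enumeration of the connected components in nonincreasing order of their sizes,
with ties broken in an arbitrary way. -/
structure ComponentOrder {n : ℕ} (G : SimpleGraph (Fin n)) where
  enum : Fin (Nat.card G.ConnectedComponent) ≃ G.ConnectedComponent
  antitone_size : ∀ a b, a ≤ b → (enum b).supp.ncard ≤ (enum a).supp.ncard

theorem nonempty_componentOrder {n : ℕ} (G : SimpleGraph (Fin n)) :
    Nonempty (ComponentOrder G) := by
  let e := (Finite.equivFin G.ConnectedComponent).symm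
  let f : Fin (Nat.card G.ConnectedComponent) → ℕᵒᵈ := fun a => OrderDual.toDual (e a).supp.ncard
  exact ⟨⟨(Tuple.sort f).trans e, fun a b hab => Tuple.monotone_sort f hab⟩⟩

/-- The vertices of the `i`-th largest component, `i = 1, 2, …`
(empty if there are fewer than `i` components). -/
def ComponentOrder.cluster {n : ℕ} {G : SimpleGraph (Fin n)} (r : ComponentOrder G) (i : ℕ) :
    Finset (Fin n) :=
  Finset.univ.filter fun v => (r.enum.symm (G.connectedComponentMk v) : ℕ) + 1 = i

/-! ### Modes of convergence -/

/-- Convergence in probability to the constant `c` of random variables `X n`, each defined on its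
own probability space `(Ω n, P n)`. -/
def TendstoInProb {Ω : ℕ → Type} [∀ n, MeasurableSpace (Ω n)] (P : ∀ n, Measure (Ω n))
    (X : ∀ n, Ω n → ℝ) (c : ℝ) : Prop :=
  ∀ ε : ℝ, 0 < ε → Tendsto (fun n => P n {ω | ε ≤ |X n ω - c|}) atTop (𝓝 0)

/-- The events `E n` occur with high probability. -/
def WHP {Ω : ℕ → Type} [∀ n, MeasurableSpace (Ω n)] (P : ∀ n, Measure (Ω n))
    (E : ∀ n, Set (Ω n)) : Prop :=
  Tendsto (fun n => P n (E n)) atTop (𝓝 1)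

end

end NorrosReittu

/-!
The percolated graph is subcritical, and the proof counts its self-avoiding paths. Write
`α = 1 / (τ - 1) ∈ (1/2, 1)`, let `w` be the weights, and let `M x y` be the
probability that `x` and `y` are adjacent in the percolated graph. The expected number of
self-avoiding paths of length `m` from `x` to `y` is at most `(M ^ m) x y`
(`law_pathAvoiding_le`). The function `h k = k^{-1/2}` satisfies `M h ≤ ρ h`, where `ρ` is of order
`π_n n^{(3-τ)/2}` and hence tends to zero (`sum_adjProb_mul_testFun_le`, `growthRate_eq`).
Moreover `w ≤ c_F n^α h` and the row sums of `M` are at most `π_n w`. Three consequences follow.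

* For a fixed hub `i`, the expected number of vertices reached by paths of length at least two is
  `o(n^α π_n)`, the expected weight of its component outside `i` is `o(n^α)`, and the probability
  that it is connected to another fixed hub is `o(1)`.
* The degree of the hub `i` is a sum of independent indicators with mean asymptotic to
  `π_n w_i = c_F i^{-α} n^α π_n`, which diverges, so it is concentrated
  (`law_degree_deviation_le`, `le_sum_adjProb_erase`). With the previous item, this gives the size
  of the component of the hub.
* A component with `s` vertices contains at least `s²/4 - s` pairs joined by a path of length
  at least two (`sq_card_le_card_longPath`). The expected number of such pairs off the first
  `K` vertices is at most `π_n² (∑_{k > K} w_k² + o(n^{2α}))`, and the sum is small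
  compared to `n^{2α}` for large `K` because `2 α > 1`. So no component off the first `K`
  vertices competes with those of the hubs (`exists_small_components`). Paths of length one
  have to be left out of the count: the number of all edges may exceed `(n^α π_n)²`.

Consequently the components of the first `i` hubs are distinct, have strictly decreasing sizes,
and all other components are smaller than the `i`-th of them, so that this one has rank `i`
(`cluster_eq_component`, `negligible_cluster_ne`), and the statements about the `i`-th largest
component become statements about the component of the vertex with label `i`.
-/

/-! ### Power sums -/

theorem sum_rpow_neg_le {a : ℝ} (ha0 : 0 ≤ a) (ha : a < 1) (m : ℕ) :
    ∑ k ∈ Finset.range m, ((k : ℝ) + 1) ^ (-a) ≤ (m : ℝ) ^ (1 - a) / (1 - a) := by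
  have h1a : 0 < 1 - a := by linarith
  induction m with
  | zero => simp [Real.zero_rpow h1a.ne']
  | succ m ih =>
    rw [Finset.sum_range_succ]
    have hm : (0 : ℝ) < m + 1 := by positivity
    have hb := rpow_one_add_le_one_add_mul_self (s := -(1 / ((m : ℝ) + 1)))
      (by rw [neg_le_neg_iff, div_le_one hm]; linarith [Nat.cast_nonneg (α := ℝ) m])
      h1a.le (by linarith)
    have e1 : 1 + -(1 / ((m : ℝ) + 1)) = m / (m + 1) := by field_simp; ring
    rw [e1, Real.div_rpow (Nat.cast_nonneg m) hm.le, div_le_iff₀ (Real.rpow_pos_of_pos hm _)] at hb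
    have e2 : ((m : ℝ) + 1) ^ (1 - a) = (m + 1) * (m + 1) ^ (-a) := by
      rw [sub_eq_add_neg, Real.rpow_add hm, Real.rpow_one]
    have e3 : (1 + (1 - a) * -(1 / ((m : ℝ) + 1))) * (m + 1) ^ (1 - a)
        = (m + 1) ^ (1 - a) - (1 - a) * (m + 1) ^ (-a) := by
      rw [e2]; field_simp; ring
    rw [e3] at hb
    rw [le_div_iff₀ h1a] at ih ⊢
    push_cast
    linarith

theorem sum_Ico_rpow_neg_le {a : ℝ} (ha : 1 < a) (m n : ℕ) :
    ∑ k ∈ Finset.Ico m n, ((k : ℝ) + 1) ^ (-a) ≤ 2 ^ a / (a - 1) * ((m : ℝ) + 1) ^ (1 - a) := by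
  have ha1 : 0 < a - 1 := by linarith
  have step : ∀ k : ℕ, ((k : ℝ) + 1) ^ (-a) ≤
      2 ^ a / (a - 1) * (((k : ℝ) + 1) ^ (1 - a) - ((k : ℝ) + 2) ^ (1 - a)) := by
    intro k
    have hk1 : (0 : ℝ) < k + 1 := by positivity
    have hk2 : (0 : ℝ) < k + 2 := by positivity
    have hb : 1 + (a - 1) / (k + 2) ≤ (((k : ℝ) + 1) / (k + 2)) ^ (1 - a) := by
      have hp : 0 < ((k : ℝ) + 1) / (k + 2) := by positivity
      have hl := Real.log_le_sub_one_of_pos hp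
      have e : ((k : ℝ) + 1) / (k + 2) - 1 = -(1 / (k + 2)) := by field_simp; ring
      rw [Real.rpow_def_of_pos hp]
      refine le_trans ?_ (Real.add_one_le_exp _)
      rw [e] at hl
      have := mul_le_mul_of_nonneg_left hl ha1.le
      have e4 : (a - 1) * -(1 / ((k : ℝ) + 2)) = -((a - 1) / (k + 2)) := by ring
      linarith
    rw [Real.div_rpow hk1.le hk2.le, le_div_iff₀ (Real.rpow_pos_of_pos hk2 _)] at hb
    have e2 : ((k : ℝ) + 2) ^ (1 - a) = (k + 2) * (k + 2) ^ (-a) := by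
      rw [sub_eq_add_neg, Real.rpow_add hk2, Real.rpow_one]
    have e3 : (1 + (a - 1) / ((k : ℝ) + 2)) * (k + 2) ^ (1 - a)
        = (k + 2) ^ (1 - a) + (a - 1) * (k + 2) ^ (-a) := by
      rw [e2]; field_simp
    rw [e3] at hb
    have h2 : (2 : ℝ) ^ (-a) * (k + 1) ^ (-a) ≤ (k + 2) ^ (-a) := by
      rw [← Real.mul_rpow (by norm_num) hk1.le]
      exact Real.rpow_le_rpow_of_nonpos hk2 (by linarith [Nat.cast_nonneg (α := ℝ) k])
        (by linarith)
    have h3 : (2 : ℝ) ^ a * 2 ^ (-a) = 1 := by rw [← Real.rpow_add two_pos]; simp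
    have h2a : (0 : ℝ) < 2 ^ a := by positivity
    rw [div_mul_eq_mul_div, le_div_iff₀ ha1]
    calc ((k : ℝ) + 1) ^ (-a) * (a - 1)
        = 2 ^ a * ((a - 1) * (2 ^ (-a) * (k + 1) ^ (-a))) := by
          linear_combination (-((k : ℝ) + 1) ^ (-a) * (a - 1)) * h3
      _ ≤ 2 ^ a * ((a - 1) * (k + 2) ^ (-a)) := by gcongr
      _ ≤ _ := by gcongr; linarith
  rcases le_total n m with h | h
  · rw [Finset.Ico_eq_empty_of_le h, Finset.sum_empty]
    positivity
  have htel : ∀ l, m ≤ l → ∑ k ∈ Finset.Ico m l, (((k : ℝ) + 1) ^ (1 - a) - ((k : ℝ) + 2) ^ (1 - a))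
      = ((m : ℝ) + 1) ^ (1 - a) - ((l : ℝ) + 1) ^ (1 - a) := by
    intro l hl
    induction l, hl using Nat.le_induction with
    | base => simp
    | succ l hl ih =>
      rw [Finset.sum_Ico_succ_top hl, ih]
      push_cast
      rw [add_assoc (l : ℝ) 1 1, one_add_one_eq_two]; ring
  calc _ ≤ ∑ k ∈ Finset.Ico m n,
        2 ^ a / (a - 1) * (((k : ℝ) + 1) ^ (1 - a) - ((k : ℝ) + 2) ^ (1 - a)) :=
        Finset.sum_le_sum fun k _ => step k
    _ = 2 ^ a / (a - 1) * (((m : ℝ) + 1) ^ (1 - a) - ((n : ℝ) + 1) ^ (1 - a)) := by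
        rw [← Finset.mul_sum, htel n h]
    _ ≤ _ := by
        gcongr
        linarith [Real.rpow_nonneg (by positivity : (0 : ℝ) ≤ (n : ℝ) + 1) (1 - a)]

/-- The kernel `min(1, (y/k)^α)` maps `k^{-1/2}` to a multiple of `y^{1/2}`: below `y` the sum
is that of `k^{-1/2}`, and above `y` the series `∑ k^{-α-1/2}` converges because `α > 1/2`. -/
theorem sum_min_one_rpow_mul_le {α : ℝ} (hα : 1 / 2 < α) {y : ℝ} (hy : 0 < y) (n : ℕ) :
    ∑ k ∈ Finset.range n, min 1 ((y / ((k : ℝ) + 1)) ^ α) * ((k : ℝ) + 1) ^ (-(1 / 2) : ℝ) ≤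
      (2 + 2 ^ (α + 1 / 2) / (α + 1 / 2 - 1)) * y ^ (1 / 2 : ℝ) := by
  set f : ℕ → ℝ := fun k => min 1 ((y / ((k : ℝ) + 1)) ^ α) * ((k : ℝ) + 1) ^ (-(1 / 2) : ℝ)
  have hf : ∀ k, 0 ≤ f k := fun k => by positivity
  set m := ⌊y⌋₊
  have hm : (m : ℝ) ≤ y := Nat.floor_le hy.le
  have hm1 : y ≤ (m : ℝ) + 1 := (Nat.lt_floor_add_one y).le
  have hsub : Finset.range n ⊆ Finset.range m ∪ Finset.Ico m n := by
    intro k hk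
    simp only [Finset.mem_union, Finset.mem_range, Finset.mem_Ico] at hk ⊢
    omega
  have hdis : Disjoint (Finset.range m) (Finset.Ico m n) := by
    rw [Finset.disjoint_left]
    intro k hk hk'
    simp only [Finset.mem_range, Finset.mem_Ico] at hk hk'
    omega
  have h1 : ∑ k ∈ Finset.range m, f k ≤ 2 * y ^ (1 / 2 : ℝ) := by
    calc _ ≤ ∑ k ∈ Finset.range m, ((k : ℝ) + 1) ^ (-(1 / 2) : ℝ) :=
          Finset.sum_le_sum fun k _ => mul_le_of_le_one_left (by positivity) (min_le_left _ _)
      _ ≤ (m : ℝ) ^ (1 - 1 / 2 : ℝ) / (1 - 1 / 2) :=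
          sum_rpow_neg_le (by norm_num) (by norm_num) m
      _ = 2 * (m : ℝ) ^ (1 / 2 : ℝ) := by norm_num; ring
      _ ≤ _ := by gcongr
  have h2 : ∑ k ∈ Finset.Ico m n, f k ≤
      2 ^ (α + 1 / 2) / (α + 1 / 2 - 1) * y ^ (1 / 2 : ℝ) := by
    have h0 : 0 < α + 1 / 2 - 1 := by linarith
    calc _ ≤ ∑ k ∈ Finset.Ico m n, y ^ α * ((k : ℝ) + 1) ^ (-(α + 1 / 2)) := by
          refine Finset.sum_le_sum fun k _ => ?_
          have hk : (0 : ℝ) < k + 1 := by positivity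
          rw [neg_add, Real.rpow_add hk, ← mul_assoc, Real.rpow_neg hk.le, ← div_eq_mul_inv,
            ← Real.div_rpow hy.le hk.le]
          exact mul_le_mul_of_nonneg_right (min_le_right _ _) (by positivity)
      _ ≤ y ^ α * (2 ^ (α + 1 / 2) / (α + 1 / 2 - 1) * ((m : ℝ) + 1) ^ (1 - (α + 1 / 2))) := by
          rw [← Finset.mul_sum]
          exact mul_le_mul_of_nonneg_left (sum_Ico_rpow_neg_le (by linarith) m n) (by positivity)
      _ ≤ y ^ α * (2 ^ (α + 1 / 2) / (α + 1 / 2 - 1) * y ^ (1 - (α + 1 / 2))) := by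
          refine mul_le_mul_of_nonneg_left (mul_le_mul_of_nonneg_left ?_ (by positivity))
            (by positivity)
          exact Real.rpow_le_rpow_of_nonpos hy hm1 (by linarith)
      _ = 2 ^ (α + 1 / 2) / (α + 1 / 2 - 1) * (y ^ α * y ^ (1 - (α + 1 / 2))) := by ring
      _ = _ := by rw [← Real.rpow_add hy]; congr 2; ring
  calc _ ≤ ∑ k ∈ Finset.range m ∪ Finset.Ico m n, f k :=
        Finset.sum_le_sum_of_subset_of_nonneg hsub fun k _ _ => hf k
    _ = _ := Finset.sum_union hdis
    _ ≤ _ := by rw [add_mul]; exact add_le_add h1 h2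

/-- A lower bound on `1 - e^{-x}` that keeps a power between the first and the second. -/
theorem sub_rpow_le_one_sub_exp_neg {x q : ℝ} (hx : 0 ≤ x) (hq1 : 1 ≤ q) (hq2 : q ≤ 2) :
    x - x ^ q ≤ 1 - Real.exp (-x) := by
  rcases le_total 1 x with h | h
  · have : x ≤ x ^ q := Real.self_le_rpow_of_one_le h hq1
    have : Real.exp (-x) ≤ 1 := Real.exp_le_one_iff.2 (by linarith)
    linarith
  · rcases hx.eq_or_lt with rfl | hx
    · simp [Real.zero_rpow (by linarith : q ≠ 0)]
    have h1 : x ^ 2 ≤ x ^ q := by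
      rw [← Real.rpow_natCast]
      exact Real.rpow_le_rpow_of_exponent_ge hx h (by simpa using hq2)
    have h2 : Real.exp (-x) ≤ 1 - x + x ^ 2 := by
      have := Real.abs_exp_sub_one_sub_id_le (x := -x) (by rw [abs_neg, abs_of_pos hx]; exact h)
      have := (abs_le.1 this).2
      nlinarith
    linarith

/-! ### Self-avoiding paths and components -/

/-- There is a self-avoiding path of length `m` from `x` to `y` in `G` none of whose vertices
belongs to `A`. The recursion adds each visited vertex to the forbidden set. -/
def PathAvoiding {V : Type*} (G : SimpleGraph V) : ℕ → Set V → V → V → Prop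
  | 0, A, x, y => x ∉ A ∧ x = y
  | m + 1, A, x, y => x ∉ A ∧ ∃ z, G.Adj x z ∧ PathAvoiding G m (insert x A) z y

namespace PathAvoiding

variable {V : Type*} {G : SimpleGraph V}

theorem start_notMem {m : ℕ} {A : Set V} {x y : V} (h : PathAvoiding G m A x y) : x ∉ A := by
  cases m <;> exact h.1

theorem congr_of_adj {G' : SimpleGraph V} {m : ℕ} {A : Set V} {x y : V}
    (hG : ∀ u v, u ∉ A → v ∉ A → G.Adj u v → G'.Adj u v) (h : PathAvoiding G m A x y) :
    PathAvoiding G' m A x y := by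
  induction m generalizing A x with
  | zero => exact h
  | succ m ih =>
    obtain ⟨hx, z, hz, hp⟩ := h
    have hzA : z ∉ A := fun h => hp.start_notMem (Set.mem_insert_of_mem _ h)
    exact ⟨hx, z, hG x z hx hzA hz, ih (fun u v hu hv => hG u v
      (fun h => hu (Set.mem_insert_of_mem _ h)) (fun h => hv (Set.mem_insert_of_mem _ h))) hp⟩

theorem of_isPath {A : Set V} {x y : V} (p : G.Walk x y) (hp : p.IsPath)
    (hA : ∀ v ∈ p.support, v ∉ A) : PathAvoiding G p.length A x y := by
  induction p generalizing A with
  | nil => exact ⟨hA _ (by simp), rfl⟩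
  | @cons x z y h p ih =>
    rw [SimpleGraph.Walk.cons_isPath_iff] at hp
    refine ⟨hA _ (by simp), z, h, ih hp.1 fun v hv hvA => ?_⟩
    rcases hvA with rfl | hvA
    · exact hp.2 hv
    · exact hA v (by simp [hv]) hvA

theorem exists_of_reachable {n : ℕ} {G : SimpleGraph (Fin n)} {A : Set (Fin n)} {x y : Fin n}
    (h : G.Reachable x y) (hA : ∀ v, G.Reachable x v → v ∉ A) (hne : x ≠ y) :
    ∃ m, m + 1 < n ∧ PathAvoiding G (m + 1) A x y := by
  obtain ⟨p, hp⟩ := h.exists_isPath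
  have hl := hp.length_lt
  rw [Fintype.card_fin] at hl
  have := of_isPath p hp (A := A) fun v hv => hA v (p.takeUntil v hv).reachable
  cases hm : p.length with
  | zero => exact absurd (SimpleGraph.Walk.eq_of_length_eq_zero hm) hne
  | succ m => exact ⟨m, by omega, hm ▸ this⟩

theorem adj_of_one {A : Set V} {x y : V} (h : PathAvoiding G 1 A x y) : G.Adj x y := by
  obtain ⟨_, z, hz, hp⟩ := h
  exact hp.2 ▸ hz

theorem two_of_adj {A : Set V} {x y z : V} (hx : x ∉ A) (hy : y ∉ A) (hz : z ∉ A)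
    (hxy : G.Adj x y) (hyz : G.Adj y z) (hxz : x ≠ z) : PathAvoiding G 2 A x z := by
  refine ⟨hx, y, hxy, ?_, z, hyz, ?_, rfl⟩
  · simp [hxy.ne', hy]
  · simp [hyz.ne', hxz.symm, hz]

end PathAvoiding

/-- There is a self-avoiding path of length at least two from `x` to `y` in `G` that avoids `A`. The
bound `m + 2 < n` holds for every self-avoiding path on `n` vertices. -/
def LongPath {n : ℕ} (G : SimpleGraph (Fin n)) (A : Set (Fin n)) (x y : Fin n) : Prop :=
  ∃ m, m + 2 < n ∧ PathAvoiding G (m + 2) A x y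

theorem longPath_of_reachable {n : ℕ} {G : SimpleGraph (Fin n)} {A : Set (Fin n)} {x y : Fin n}
    (h : G.Reachable x y) (hA : ∀ v, G.Reachable x v → v ∉ A) (hne : x ≠ y)
    (hadj : ¬ G.Adj x y) : LongPath G A x y := by
  obtain ⟨m, hm, hp⟩ := PathAvoiding.exists_of_reachable h hA hne
  cases m with
  | zero => exact absurd hp.adj_of_one hadj
  | succ m => exact ⟨m, hm, hp⟩

open Classical in
/-- The vertex set of the connected component of `x`. -/
noncomputable def component {n : ℕ} (G : SimpleGraph (Fin n)) (x : Fin n) : Finset (Fin n) :=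
  Finset.univ.filter fun v => G.Reachable x v

@[simp]
theorem mem_component {n : ℕ} {G : SimpleGraph (Fin n)} {x v : Fin n} :
    v ∈ component G x ↔ G.Reachable x v := by simp [component]

theorem component_eq_of_reachable {n : ℕ} {G : SimpleGraph (Fin n)} {x y : Fin n}
    (h : G.Reachable x y) : component G x = component G y := by
  ext v
  simp only [mem_component]
  exact ⟨h.symm.trans, h.trans⟩

open Classical in
/-- In a component with `s` vertices, a quarter of all pairs of vertices, up to a term of order
`s`, are joined by a path of length at least two. If some vertex has more than `s / 2` neighbours
that it cannot reach by such a path, any two of them are joined through this vertex; otherwise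
every vertex reaches about half of the component by such paths. -/
theorem sq_card_le_card_longPath {n : ℕ} {G : SimpleGraph (Fin n)} {A : Set (Fin n)}
    (x₀ : Fin n) (hA : ∀ v, G.Reachable x₀ v → v ∉ A) :
    (component G x₀).card ^ 2 ≤
      4 * (Finset.univ.filter fun p : Fin n × Fin n => LongPath G A p.1 p.2).card +
        4 * (component G x₀).card := by
  set S := component G x₀
  set L := Finset.univ.filter fun p : Fin n × Fin n => LongPath G A p.1 p.2
  have hS : ∀ {v}, v ∈ S ↔ G.Reachable x₀ v := by simp [S]
  let B : Fin n → Finset (Fin n) := fun x => S.filter fun y => x ≠ y ∧ ¬ LongPath G A x y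
  have hadj : ∀ x ∈ S, ∀ y ∈ B x, G.Adj x y := by
    intro x hx y hy
    simp only [B, Finset.mem_filter, hS] at hy
    rw [hS] at hx
    by_contra hn
    exact hy.2.2 (longPath_of_reachable (hx.symm.trans hy.1) (fun v hv => hA v (hx.trans hv))
      hy.2.1 hn)
  by_cases hcase : ∀ x ∈ S, 2 * (B x).card ≤ S.card
  · have h1 : ∀ x ∈ S, S.card ≤ 2 * (S.filter fun y => LongPath G A x y).card + 2 := by
      intro x hx
      have hsub : S ⊆ (B x ∪ S.filter fun y => LongPath G A x y) ∪ {x} := by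
        intro y hy
        by_cases hxy : x = y
        · simp [hxy]
        by_cases hl : LongPath G A x y <;> simp [B, hy, hxy, hl]
      have := (Finset.card_le_card hsub).trans (Finset.card_union_le _ _)
      have h2 := Finset.card_union_le (B x) (S.filter fun y => LongPath G A x y)
      have h3 := hcase x hx
      rw [Finset.card_singleton] at this
      omega
    have h2 : ∑ x ∈ S, (S.filter fun y => LongPath G A x y).card ≤ L.card := by
      rw [← Finset.card_sigma]
      refine Finset.card_le_card_of_injOn (fun p => (p.1, p.2)) ?_ ?_
      · rintro ⟨x, y⟩ h
        simp only [Finset.coe_sigma, Set.mem_sigma_iff, Finset.mem_coe, Finset.mem_filter] at h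
        simp [L, h.2.2]
      · rintro ⟨x, y⟩ _ ⟨x', y'⟩ _ h
        simp only [Prod.mk.injEq] at h
        simp [h.1, h.2]
    have h3 := Finset.sum_le_sum h1
    rw [Finset.sum_const, smul_eq_mul, Finset.sum_add_distrib, ← Finset.mul_sum,
      Finset.sum_const, smul_eq_mul] at h3
    nlinarith
  · push Not at hcase
    obtain ⟨x, hx, hB⟩ := hcase
    have h1 : (B x).offDiag ⊆ L := by
      rintro ⟨y, z⟩ h
      rw [Finset.mem_offDiag] at h
      have hy := hadj x hx y h.1
      have hz := hadj x hx z h.2.1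
      have hxr := hS.1 hx
      have hxyz : y ≠ x ∧ x ≠ z := ⟨hy.ne', hz.ne⟩
      have hn : 2 < n := by
        have := (Finset.card_le_univ ({y, x, z} : Finset (Fin n)))
        rw [Fintype.card_fin] at this
        rw [Finset.card_insert_of_notMem (by simp [hxyz.1, h.2.2]),
          Finset.card_pair hxyz.2] at this
        omega
      simp only [L, Finset.mem_filter, Finset.mem_univ, true_and]
      exact ⟨0, hn, PathAvoiding.two_of_adj (hA y (hxr.trans hy.reachable)) (hA x hxr)
        (hA z (hxr.trans hz.reachable)) hy.symm hz h.2.2⟩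
    have h2 := Finset.card_le_card h1
    rw [Finset.offDiag_card] at h2
    have h3 : (B x).card * (B x).card ≤ L.card + (B x).card := by omega
    have h4 : (B x).card ≤ S.card := Finset.card_le_card (Finset.filter_subset _ _)
    nlinarith

open NorrosReittu in
/-- Let `i` vertices lie in distinct components. If the component of the last one is strictly
smaller than those of the others, and strictly larger than every component that contains none
of the `i` vertices, then it is the `i`-th component in every admissible ordering. -/
theorem cluster_eq_component {n : ℕ} {G : SimpleGraph (Fin n)} (r : ComponentOrder G) {i : ℕ}
    (hub : Fin i → Fin n) (hi : 0 < i)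
    (hdist : ∀ a b, a ≠ b → ¬ G.Reachable (hub a) (hub b))
    (hlarge : ∀ a : Fin i, (a : ℕ) + 1 < i →
      (component G (hub ⟨i - 1, by omega⟩)).card <
        (component G (hub a)).card)
    (hsmall : ∀ x, (∀ a, ¬ G.Reachable (hub a) x) →
      (component G x).card <
        (component G (hub ⟨i - 1, by omega⟩)).card) :
    r.cluster i = component G (hub ⟨i - 1, by omega⟩) := by
  set l : Fin i := ⟨i - 1, by omega⟩
  have hsupp : ∀ x, (G.connectedComponentMk x).supp.ncard =
      (component G x).card := by
    intro x
    rw [← Set.ncard_coe_finset]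
    congr 1
    ext v
    simp [SimpleGraph.ConnectedComponent.eq, SimpleGraph.reachable_comm]
  let idx : Fin n → Fin (Nat.card G.ConnectedComponent) := fun x =>
    r.enum.symm (G.connectedComponentMk x)
  have hidx : ∀ x y, idx x = idx y ↔ G.Reachable x y := by
    intro x y
    simp only [idx, EmbeddingLike.apply_eq_iff_eq, SimpleGraph.ConnectedComponent.eq]
  have hmono : ∀ x y, idx x ≤ idx y → (component G y).card ≤
      (component G x).card := by
    intro x y h
    have := r.antitone_size _ _ h
    simpa only [idx, Equiv.apply_symm_apply, hsupp] using this
  -- the indices below that of the component of `hub l` are those of the other given components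
  have himage : Finset.univ.filter (fun t => t < idx (hub l)) =
      (Finset.univ.filter fun a : Fin i => (a : ℕ) + 1 < i).image fun a => idx (hub a) := by
    ext t
    simp only [Finset.mem_filter, Finset.mem_univ, true_and, Finset.mem_image]
    constructor
    · intro ht
      obtain ⟨x, hx⟩ : ∃ x, idx x = t := by
        obtain ⟨x, hx⟩ := (r.enum t).exists_rep
        exact ⟨x, by
          rw [Equiv.symm_apply_eq]; exact hx⟩
      subst hx
      have hsz := hmono x (hub l) ht.le
      by_cases hex : ∃ a, G.Reachable (hub a) x
      · obtain ⟨a, ha⟩ := hex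
        refine ⟨a, ?_, (hidx _ _).2 ha⟩
        by_contra hai
        have : a = l := by ext; simp [l]; omega
        subst this
        exact absurd ((hidx _ _).2 ha.symm) ht.ne
      · push Not at hex
        exact absurd (hsmall x hex) (not_lt.2 hsz)
    · rintro ⟨a, ha, rfl⟩
      by_contra hlt
      exact absurd (hlarge a ha) (not_lt.2 (hmono _ _ (not_lt.1 hlt)))
  have hcard : ((idx (hub l) : ℕ)) = i - 1 := by
    have h1 : (Finset.univ.filter (fun t => t < idx (hub l))).card = (idx (hub l) : ℕ) := by
      rw [Finset.filter_gt_eq_Iio, Fin.card_Iio]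
    rw [← h1, himage, Finset.card_image_of_injective]
    · have : (Finset.univ.filter fun a : Fin i => (a : ℕ) + 1 < i) = Finset.univ.erase l := by
        ext a
        simp [l, Fin.ext_iff]
        omega
      rw [this, Finset.card_erase_of_mem (Finset.mem_univ _), Finset.card_univ, Fintype.card_fin]
    · intro a b hab
      by_contra hne
      exact hdist a b hne ((hidx _ _).1 hab)
  ext v
  simp only [ComponentOrder.cluster, Finset.mem_filter, Finset.mem_univ, true_and, mem_component]
  rw [← hidx, Fin.ext_iff, hcard]
  change (idx v : ℕ) + 1 = i ↔ _
  omega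

/-! ### Powers of nonnegative matrices -/

section Matrix

variable {V : Type*} [Fintype V] [DecidableEq V]

theorem pow_entry_nonneg {N : Matrix V V ℝ} (hN : ∀ x y, 0 ≤ N x y) (m : ℕ) (x y : V) :
    0 ≤ (N ^ m) x y := by
  induction m generalizing x y with
  | zero => rw [pow_zero, Matrix.one_apply]; split_ifs <;> norm_num
  | succ m ih =>
    rw [pow_succ, Matrix.mul_apply]
    exact Finset.sum_nonneg fun z _ => mul_nonneg (ih _ _) (hN _ _)

/-- A vector `h` with `N h ≤ ρ h` satisfies `N ^ m h ≤ ρ ^ m h`. -/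
theorem sum_pow_mul_le {N : Matrix V V ℝ} (hN : ∀ x y, 0 ≤ N x y) {h : V → ℝ} {ρ : ℝ}
    (hρ : 0 ≤ ρ) (hNh : ∀ x, ∑ y, N x y * h y ≤ ρ * h x) (m : ℕ) (x : V) :
    ∑ y, (N ^ m) x y * h y ≤ ρ ^ m * h x := by
  induction m generalizing x with
  | zero => simp [Matrix.one_apply]
  | succ m ih =>
    calc ∑ y, (N ^ (m + 1)) x y * h y = ∑ z, N x z * ∑ y, (N ^ m) z y * h y := by
          simp only [pow_succ', Matrix.mul_apply, Finset.sum_mul, Finset.mul_sum]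
          rw [Finset.sum_comm]
          simp only [mul_assoc]
      _ ≤ ∑ z, N x z * (ρ ^ m * h z) :=
          Finset.sum_le_sum fun z _ => mul_le_mul_of_nonneg_left (ih z) (hN x z)
      _ = ρ ^ m * ∑ z, N x z * h z := by
          rw [Finset.mul_sum]; exact Finset.sum_congr rfl fun z _ => by ring
      _ ≤ ρ ^ m * (ρ * h x) := mul_le_mul_of_nonneg_left (hNh x) (by positivity)
      _ = _ := by ring

theorem sum_range_pow_succ_le {ρ : ℝ} (hρ : 0 ≤ ρ) (hρ2 : ρ ≤ 1 / 2) (n : ℕ) :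
    ∑ m ∈ Finset.range n, ρ ^ (m + 1) ≤ 2 * ρ := by
  have h1 : ∑ m ∈ Finset.range n, ρ ^ m ≤ (1 - ρ)⁻¹ := by
    rw [← tsum_geometric_of_lt_one hρ (by linarith)]
    exact (summable_geometric_of_lt_one hρ (by linarith)).sum_le_tsum _
      fun m _ => pow_nonneg hρ m
  have h2 : (1 - ρ)⁻¹ ≤ 2 := by
    rw [inv_le_comm₀ (by linarith) two_pos]; linarith
  simp only [pow_succ]
  rw [← Finset.sum_mul]
  exact mul_le_mul_of_nonneg_right (h1.trans h2) hρ

theorem sum_range_sum_pow_mul_le {N : Matrix V V ℝ} (hN : ∀ x y, 0 ≤ N x y) {h : V → ℝ} {ρ : ℝ}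
    (hρ : 0 ≤ ρ) (hρ2 : ρ ≤ 1 / 2) (hh : ∀ x, 0 ≤ h x)
    (hNh : ∀ x, ∑ y, N x y * h y ≤ ρ * h x) (n : ℕ) (x : V) :
    ∑ m ∈ Finset.range n, ∑ y, (N ^ (m + 1)) x y * h y ≤ 2 * ρ * h x := by
  calc _ ≤ ∑ m ∈ Finset.range n, ρ ^ (m + 1) * h x :=
        Finset.sum_le_sum fun m _ => sum_pow_mul_le hN hρ hNh (m + 1) x
    _ ≤ _ := by
        rw [← Finset.sum_mul]
        exact mul_le_mul_of_nonneg_right (sum_range_pow_succ_le hρ hρ2 n) (hh x)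

/-- The first and the last step of a path of length `m + 2` are bounded by row sums, so that the
total number of paths reduces to the quadratic form of the intermediate power. -/
theorem sum_sum_pow_add_two_le {N : Matrix V V ℝ} (hN : ∀ x y, 0 ≤ N x y)
    (hsymm : ∀ x y, N x y = N y x) {u : V → ℝ} (hrow : ∀ x, ∑ y, N x y ≤ u x) (m : ℕ) :
    ∑ x, ∑ y, (N ^ (m + 2)) x y ≤ ∑ z, u z * ∑ z', (N ^ m) z z' * u z' := by
  have hu : ∀ x, 0 ≤ u x := fun x => (Finset.sum_nonneg fun y _ => hN x y).trans (hrow x)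
  calc ∑ x, ∑ y, (N ^ (m + 2)) x y
      = ∑ z, (∑ x, N z x) * ∑ z', (N ^ m) z z' * ∑ y, N z' y := by
        have e : N ^ (m + 2) = N * (N ^ m * N) := by rw [pow_succ, pow_succ', mul_assoc]
        calc _ = ∑ x, ∑ z, N x z * ∑ z', (N ^ m) z z' * ∑ y, N z' y := by
              refine Finset.sum_congr rfl fun x _ => ?_
              simp only [e, Matrix.mul_apply]
              rw [Finset.sum_comm]
              refine Finset.sum_congr rfl fun z _ => ?_
              rw [← Finset.mul_sum, Finset.sum_comm]
              simp only [Finset.mul_sum]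
          _ = _ := by
              rw [Finset.sum_comm]
              refine Finset.sum_congr rfl fun z _ => ?_
              rw [← Finset.sum_mul]
              congr 1
              exact Finset.sum_congr rfl fun x _ => hsymm x z
    _ ≤ _ := by
        refine Finset.sum_le_sum fun z _ => mul_le_mul (hrow z) ?_ ?_ (hu z)
        · exact Finset.sum_le_sum fun z' _ =>
            mul_le_mul_of_nonneg_left (hrow z') (pow_entry_nonneg hN m z z')
        · exact Finset.sum_nonneg fun z' _ => mul_nonneg (pow_entry_nonneg hN m z z')
            (Finset.sum_nonneg fun y _ => hN z' y)

end Matrix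

/-! ### Independence of the open edges and the probability of paths -/

namespace NorrosReittu

/-- The pair `e` is an edge of the percolated graph (for a non-diagonal pair). -/
def isOpen {n : ℕ} (e : Sym2 (Fin n)) (ω : Config n) : Bool := ω.1 e && ω.2 e

instance isProbabilityMeasure_law {n : ℕ} (w : Fin n → ℝ) (p : unitInterval) :
    IsProbabilityMeasure (law w p) := by unfold law; infer_instance

/-- The probabilities that two vertices are adjacent in the percolated graph (with a harmless
positive diagonal). -/
noncomputable def adjProb {n : ℕ} (w : Fin n → ℝ) (p : unitInterval) :
    Matrix (Fin n) (Fin n) ℝ :=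
  Matrix.of fun x y => (p : ℝ) * edgeProb w s(x, y)

variable {n : ℕ} {w : Fin n → ℝ} {p : unitInterval}

theorem percGraph_adj {ω : Config n} {x y : Fin n} :
    (percGraph ω).Adj x y ↔ x ≠ y ∧ isOpen s(x, y) ω = true := by
  simp only [percGraph, nrGraph, SimpleGraph.fromEdgeSet_adj, Set.mem_ofPred_eq, isOpen,
    SimpleGraph.mem_edgeSet, Bool.and_eq_true]
  tauto

theorem iIndepFun_isOpen (w : Fin n → ℝ) (p : unitInterval) :
    iIndepFun (fun e => isOpen (n := n) e) (law w p) := by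
  have hmp := measurePreserving_arrowProdEquivProdArrow Bool Bool (Sym2 (Fin n))
    (fun e => bernoulliMeasure true false (edgeProb w e)) (fun _ => bernoulliMeasure true false p)
  have h := iIndepFun_pi (μ := fun e : Sym2 (Fin n) =>
      (bernoulliMeasure true false (edgeProb w e)).prod (bernoulliMeasure true false p))
    (X := fun _ (b : Bool × Bool) => (b.1 && b.2)) (fun _ => (measurable_of_finite _).aemeasurable)
  rw [law, ← hmp.map_eq]
  have := Measure.isProbabilityMeasure_map (μ := Measure.pi fun e : Sym2 (Fin n) =>
    (bernoulliMeasure true false (edgeProb w e)).prod (bernoulliMeasure true false p))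
    hmp.measurable.aemeasurable
  rw [iIndepFun_iff_map_fun_eq_pi_map (fun e => (measurable_of_finite _).aemeasurable)] at h ⊢
  rw [Measure.map_map (measurable_of_finite _) hmp.measurable]
  refine Eq.trans h ?_
  congr 1
  funext e
  rw [Measure.map_map (measurable_of_finite _) hmp.measurable]
  rfl

theorem law_isOpen (e : Sym2 (Fin n)) :
    (law w p).real {ω | isOpen e ω = true} = p * edgeProb w e := by
  have hset : {ω : Config n | isOpen e ω = true} = {a | a e = true} ×ˢ {a | a e = true} := by
    ext ω; simp [isOpen]
  have hpi : ∀ q : Sym2 (Fin n) → unitInterval,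
      (Measure.pi fun e => bernoulliMeasure true false (q e)).real {a | a e = true} = q e := by
    intro q
    have hm := measurePreserving_eval (fun e => bernoulliMeasure true false (q e)) e
    have := hm.measureReal_preimage (s := {true}) (MeasurableSet.singleton _).nullMeasurableSet
    rw [bernoulliMeasure_real_apply_of_mem_of_notMem _ (MeasurableSet.singleton _) (by simp)
      (by simp)] at this
    rw [← this]
    rfl
  rw [hset, law, measureReal_prod_prod, hpi, hpi fun _ => p, mul_comm]

/-- An edge at `x` is independent of every event that ignores the edges at `x`. -/
theorem law_adj_inter {x z : Fin n} (hxz : x ≠ z) {B : Set (Config n)}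
    (hB : ∀ ω ω', (∀ e, x ∉ e → isOpen e ω = isOpen e ω') → ω ∈ B → ω' ∈ B) :
    (law w p).real ({ω | (percGraph ω).Adj x z} ∩ B) = adjProb w p x z * (law w p).real B := by
  classical
  set S : Finset (Sym2 (Fin n)) := {s(x, z)}
  set T : Finset (Sym2 (Fin n)) := Finset.univ.filter fun e => x ∉ e
  have hST : Disjoint S T := by simp [S, T]
  have hind := iIndepFun.indepFun_finset S T hST (iIndepFun_isOpen w p)
    fun e => measurable_of_finite _
  have h1 : {ω : Config n | (percGraph ω).Adj x z} =
      (fun ω (e : S) => isOpen e.1 ω) ⁻¹' {g | g ⟨s(x, z), by simp [S]⟩ = true} := by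
    ext ω; simp [percGraph_adj, hxz]
  have h2 : B = (fun ω (e : T) => isOpen e.1 ω) ⁻¹' ((fun ω (e : T) => isOpen e.1 ω) '' B) := by
    refine subset_antisymm (Set.subset_preimage_image _ _) ?_
    rintro ω' ⟨ω, hω, h⟩
    exact hB ω ω' (fun e he => congrFun h ⟨e, by simp [T, he]⟩) hω
  have h3 : (law w p).real {ω | (percGraph ω).Adj x z} = adjProb w p x z := by
    simp only [percGraph_adj, hxz, ne_eq, not_false_iff, true_and]
    exact law_isOpen s(x, z)
  have := hind.measure_inter_preimage_eq_mul _ _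
    (Set.toFinite {g | g ⟨s(x, z), by simp [S]⟩ = true}).measurableSet
    (Set.toFinite ((fun ω (e : T) => isOpen e.1 ω) '' B)).measurableSet
  rw [← h1, ← h2] at this
  rw [measureReal_def, this, ENNReal.toReal_mul, ← measureReal_def, ← measureReal_def, h3]

theorem adjProb_nonneg (x y : Fin n) : 0 ≤ adjProb w p x y :=
  mul_nonneg p.2.1 (edgeProb w s(x, y)).2.1

theorem adjProb_symm (x y : Fin n) : adjProb w p x y = adjProb w p y x := by
  simp only [adjProb, Matrix.of_apply, Sym2.eq_swap]

/-- The expected number of self-avoiding paths between two vertices is at most an entry of a power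
of the matrix of connection probabilities: the first edge is independent of the remainder
of the path, which does not return to the first vertex. -/
theorem law_pathAvoiding_le {N : Matrix (Fin n) (Fin n) ℝ} (hN : ∀ x y, 0 ≤ N x y)
    {A₀ : Set (Fin n)} (hle : ∀ x y, x ∉ A₀ → y ∉ A₀ → adjProb w p x y ≤ N x y) (m : ℕ)
    {A : Set (Fin n)} (hA : A₀ ⊆ A) (x y : Fin n) :
    (law w p).real {ω | PathAvoiding (percGraph ω) m A x y} ≤ (N ^ m) x y := by
  induction m generalizing A x with
  | zero =>
    rw [pow_zero, Matrix.one_apply]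
    split_ifs with h
    · exact measureReal_le_one
    · have : {ω : Config n | PathAvoiding (percGraph ω) 0 A x y} = ∅ := by
        ext ω; simp [PathAvoiding, h]
      simp [this]
  | succ m ih =>
    have hpos := pow_entry_nonneg hN
    have hset : {ω : Config n | PathAvoiding (percGraph ω) (m + 1) A x y} ⊆
        ⋃ z, {ω | x ∉ A ∧ z ∉ A ∧ x ≠ z} ∩ ({ω | (percGraph ω).Adj x z} ∩
          {ω | PathAvoiding (percGraph ω) m (insert x A) z y}) := by
      rintro ω ⟨hx, z, hz, hp⟩
      exact Set.mem_iUnion.2 ⟨z, ⟨hx, fun h => hp.start_notMem (Set.mem_insert_of_mem _ h),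
        hz.ne⟩, hz, hp⟩
    rw [pow_succ', Matrix.mul_apply]
    refine (measureReal_mono hset).trans ((measureReal_iUnion_fintype_le _).trans ?_)
    refine Finset.sum_le_sum fun z _ => ?_
    by_cases hc : x ∉ A ∧ z ∉ A ∧ x ≠ z
    · refine (measureReal_mono Set.inter_subset_right).trans ?_
      rw [law_adj_inter hc.2.2]
      · exact mul_le_mul (hle x z (fun h => hc.1 (hA h)) fun h => hc.2.1 (hA h))
          (ih (hA.trans (Set.subset_insert _ _)) z) measureReal_nonneg (hN _ _)
      · intro ω ω' he h
        refine PathAvoiding.congr_of_adj (fun u v hu hv huv => ?_) h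
        rw [percGraph_adj] at huv ⊢
        refine ⟨huv.1, ?_⟩
        rw [← he _ ?_]
        · exact huv.2
        · rw [Sym2.mem_iff]
          rintro (rfl | rfl)
          · exact hu (Set.mem_insert _ _)
          · exact hv (Set.mem_insert _ _)
    · have : {ω : Config n | x ∉ A ∧ z ∉ A ∧ x ≠ z} = ∅ := by ext; simpa using hc
      rw [this, Set.empty_inter, measureReal_empty]
      exact mul_nonneg (hN _ _) (hpos m z y)

theorem law_exists_pathAvoiding_le {N : Matrix (Fin n) (Fin n) ℝ} (hN : ∀ x y, 0 ≤ N x y)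
    {A : Set (Fin n)} (hle : ∀ x y, x ∉ A → y ∉ A → adjProb w p x y ≤ N x y) (k : ℕ)
    (x y : Fin n) :
    (law w p).real {ω | ∃ m, m + k < n ∧ PathAvoiding (percGraph ω) (m + k) A x y} ≤
      ∑ m ∈ Finset.range n, (N ^ (m + k)) x y := by
  have hset : {ω : Config n | ∃ m, m + k < n ∧ PathAvoiding (percGraph ω) (m + k) A x y} ⊆
      ⋃ m ∈ Finset.range n, {ω | PathAvoiding (percGraph ω) (m + k) A x y} := by
    rintro ω ⟨m, hm, h⟩
    exact Set.mem_biUnion (x := m) (by simp; omega) h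
  exact (measureReal_mono hset (measure_ne_top _ _)).trans
    ((measureReal_biUnion_finset_le _ _).trans (Finset.sum_le_sum fun m _ =>
      law_pathAvoiding_le hN hle (m + k) subset_rfl x y))

theorem edgeProb_eq (hw : ∀ x, 0 ≤ w x) (x y : Fin n) :
    (edgeProb w s(x, y) : ℝ) = 1 - Real.exp (-(w x * w y / ∑ k, w k)) := by
  have h : 0 ≤ w x * w y / ∑ k, w k :=
    div_nonneg (mul_nonneg (hw x) (hw y)) (Finset.sum_nonneg fun k _ => hw k)
  have hmem : 1 - Real.exp (-(w x * w y / ∑ k, w k)) ∈ Set.Icc (0 : ℝ) 1 := by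
    constructor
    · linarith [Real.exp_le_one_iff.2 (neg_nonpos.2 h)]
    · linarith [Real.exp_pos (-(w x * w y / ∑ k, w k))]
  change ((Set.projIcc (0 : ℝ) 1 zero_le_one (1 - Real.exp (-(w x * w y / ∑ k, w k))) :
    unitInterval) : ℝ) = _
  rw [Set.projIcc_of_mem zero_le_one hmem]

theorem edgeProb_le (hw : ∀ x, 0 ≤ w x) (x y : Fin n) :
    (edgeProb w s(x, y) : ℝ) ≤ w x * w y / ∑ k, w k := by
  rw [edgeProb_eq hw]
  linarith [Real.add_one_le_exp (-(w x * w y / ∑ k, w k))]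

theorem sum_edgeProb_le (hw : ∀ x, 0 ≤ w x) (x : Fin n) :
    ∑ y, (edgeProb w s(x, y) : ℝ) ≤ w x := by
  calc _ ≤ ∑ y, w x * w y / ∑ k, w k := Finset.sum_le_sum fun y _ => edgeProb_le hw x y
    _ = w x * ((∑ k, w k) / ∑ k, w k) := by
        rw [← Finset.sum_div, ← Finset.mul_sum, mul_div_assoc]
    _ ≤ w x := mul_le_of_le_one_right (hw x) (div_self_le_one _)

theorem sum_adjProb_le (hw : ∀ x, 0 ≤ w x) (x : Fin n) :
    ∑ y, adjProb w p x y ≤ p * w x := by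
  simp only [adjProb, Matrix.of_apply]
  rw [← Finset.mul_sum]
  exact mul_le_mul_of_nonneg_left (sum_edgeProb_le hw x) p.2.1

section PathSums

variable {h : Fin n → ℝ} {ρ b : ℝ} (hρ : 0 ≤ ρ) (hρ2 : ρ ≤ 1 / 2) (hh : ∀ x, 0 < h x)
  (hMh : ∀ x, ∑ y, adjProb w p x y * h y ≤ ρ * h x)

include hρ hρ2 hh hMh

/-- The sum of the powers of the matrix of connection probabilities, applied to `h`, is at most
`2 ρ h`; a single entry is then at most `2 ρ h x / h y`. -/
theorem law_reachable_le {x y : Fin n} (hxy : x ≠ y) :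
    (law w p).real {ω | (percGraph ω).Reachable x y} ≤ 2 * ρ * h x / h y := by
  have hsub : {ω : Config n | (percGraph ω).Reachable x y} ⊆
      {ω | ∃ m, m + 1 < n ∧ PathAvoiding (percGraph ω) (m + 1) ∅ x y} :=
    fun ω hω => PathAvoiding.exists_of_reachable hω (by simp) hxy
  rw [le_div_iff₀ (hh y)]
  refine (mul_le_mul_of_nonneg_right ((measureReal_mono hsub).trans (law_exists_pathAvoiding_le
    adjProb_nonneg (fun _ _ _ _ => le_rfl) 1 x y)) (hh y).le).trans ?_
  refine le_trans ?_ (sum_range_sum_pow_mul_le (adjProb_nonneg (w := w) (p := p)) hρ hρ2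
    (fun x => (hh x).le) hMh n x)
  rw [Finset.sum_mul]
  exact Finset.sum_le_sum fun m _ => Finset.single_le_sum
    (f := fun y => (adjProb w p ^ (m + 1)) x y * h y)
    (fun y _ => mul_nonneg (pow_entry_nonneg adjProb_nonneg _ _ _) (hh y).le) (Finset.mem_univ y)

/-- The expected weight of the component of `x`, the vertex `x` itself excluded. -/
theorem sum_law_reachable_mul_le (hb : 0 ≤ b) (hwb : ∀ x, w x ≤ b * h x)
    (x : Fin n) :
    ∑ y, w y * (law w p).real {ω | (percGraph ω).Reachable x y ∧ x ≠ y} ≤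
      2 * ρ * b * h x := by
  calc _ ≤ ∑ y, ∑ m ∈ Finset.range n, b * ((adjProb w p ^ (m + 1)) x y * h y) := by
        refine Finset.sum_le_sum fun y _ => ?_
        have hsub : {ω : Config n | (percGraph ω).Reachable x y ∧ x ≠ y} ⊆
            {ω | ∃ m, m + 1 < n ∧ PathAvoiding (percGraph ω) (m + 1) ∅ x y} :=
          fun ω hω => PathAvoiding.exists_of_reachable hω.1 (by simp) hω.2
        have h1 := (measureReal_mono hsub).trans (law_exists_pathAvoiding_le (w := w) (p := p)
          adjProb_nonneg (fun _ _ _ _ => le_rfl) 1 x y)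
        calc _ ≤ (b * h y) * ∑ m ∈ Finset.range n, (adjProb w p ^ (m + 1)) x y :=
              mul_le_mul (hwb y) h1 measureReal_nonneg (mul_nonneg hb (hh y).le)
          _ = _ := by
              rw [Finset.mul_sum]
              exact Finset.sum_congr rfl fun m _ => by ring
    _ = b * ∑ m ∈ Finset.range n, ∑ y, (adjProb w p ^ (m + 1)) x y * h y := by
        rw [Finset.sum_comm]
        simp only [Finset.mul_sum]
    _ ≤ b * (2 * ρ * h x) := mul_le_mul_of_nonneg_left (sum_range_sum_pow_mul_le
        (adjProb_nonneg (w := w) (p := p)) hρ hρ2 (fun x => (hh x).le) hMh n x) hb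
    _ = _ := by ring

/-- The expected number of vertices reached from `x` by a path of length at least two. The last step
contributes a row sum, at most `p w z`, which is the source of the factor `p`. -/
theorem sum_law_longPath_le (hw : ∀ x, 0 ≤ w x) (hb : 0 ≤ b) (hwb : ∀ x, w x ≤ b * h x)
    (x : Fin n) :
    ∑ y, (law w p).real {ω | LongPath (percGraph ω) ∅ x y} ≤ p * (2 * ρ * b * h x) := by
  have hp : 0 ≤ (p : ℝ) := p.2.1
  calc _ ≤ ∑ y, ∑ m ∈ Finset.range n, (adjProb w p ^ (m + 2)) x y :=
        Finset.sum_le_sum fun y _ => law_exists_pathAvoiding_le (w := w) (p := p)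
          adjProb_nonneg (fun _ _ _ _ => le_rfl) 2 x y
    _ = ∑ m ∈ Finset.range n, ∑ z, (adjProb w p ^ (m + 1)) x z * ∑ y, adjProb w p z y := by
        rw [Finset.sum_comm]
        refine Finset.sum_congr rfl fun m _ => ?_
        simp only [pow_succ _ (m + 1), Matrix.mul_apply, Finset.mul_sum]
        rw [Finset.sum_comm]
    _ ≤ ∑ m ∈ Finset.range n, ∑ z, (adjProb w p ^ (m + 1)) x z * (p * (b * h z)) := by
        refine Finset.sum_le_sum fun m _ => Finset.sum_le_sum fun z _ => ?_
        exact mul_le_mul_of_nonneg_left ((sum_adjProb_le hw z).trans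
          (mul_le_mul_of_nonneg_left (hwb z) hp)) (pow_entry_nonneg adjProb_nonneg _ _ _)
    _ = p * (b * ∑ m ∈ Finset.range n, ∑ z, (adjProb w p ^ (m + 1)) x z * h z) := by
        simp only [Finset.mul_sum]
        refine Finset.sum_congr rfl fun m _ => Finset.sum_congr rfl fun z _ => by ring
    _ ≤ p * (b * (2 * ρ * h x)) := by
        gcongr
        exact sum_range_sum_pow_mul_le (adjProb_nonneg (w := w) (p := p)) hρ hρ2
          (fun x => (hh x).le) hMh n x
    _ = _ := by ring

open Classical in
/-- The expected number of pairs joined by a path of length at least two off `A`. The leading term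
counts the pairs of neighbours of a common vertex. -/
theorem sum_sum_law_longPath_le (hw : ∀ x, 0 ≤ w x) (hb : 0 ≤ b) (hwb : ∀ x, w x ≤ b * h x)
    (A : Set (Fin n)) :
    ∑ x, ∑ y, (law w p).real {ω | LongPath (percGraph ω) A x y} ≤
      (p : ℝ) ^ 2 * (∑ z, (if z ∈ A then 0 else w z ^ 2) + 2 * ρ * b * ∑ z, w z * h z) := by
  have hp : 0 ≤ (p : ℝ) := p.2.1
  set N : Matrix (Fin n) (Fin n) ℝ :=
    Matrix.of fun x y => if x ∈ A ∨ y ∈ A then 0 else adjProb w p x y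
  have hN : ∀ x y, 0 ≤ N x y := by
    intro x y
    simp only [N, Matrix.of_apply]
    split_ifs
    · rfl
    · exact adjProb_nonneg x y
  have hNle : ∀ x y, N x y ≤ adjProb w p x y := by
    intro x y
    simp only [N, Matrix.of_apply]
    split_ifs
    · exact adjProb_nonneg x y
    · rfl
  have hNsymm : ∀ x y, N x y = N y x := by
    intro x y
    simp only [N, Matrix.of_apply, or_comm, adjProb_symm x y]
  have hNh : ∀ x, ∑ y, N x y * h y ≤ ρ * h x := fun x =>
    (Finset.sum_le_sum fun y _ => mul_le_mul_of_nonneg_right (hNle x y) (hh y).le).trans (hMh x)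
  set u : Fin n → ℝ := fun z => p * if z ∈ A then 0 else w z
  have hrow : ∀ x, ∑ y, N x y ≤ u x := by
    intro x
    by_cases hx : x ∈ A
    · simp [N, u, hx]
    · simp only [u, hx, if_false]
      exact (Finset.sum_le_sum fun y _ => hNle x y).trans (sum_adjProb_le hw x)
  have hu0 : ∀ z, 0 ≤ u z := fun z =>
    (Finset.sum_nonneg fun y _ => hN z y).trans (hrow z)
  have huw : ∀ z, u z ≤ p * w z := by
    intro z
    refine mul_le_mul_of_nonneg_left ?_ hp
    split_ifs
    · exact hw z
    · rfl
  have hub : ∀ z, u z ≤ p * (b * h z) := fun z =>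
    (huw z).trans (mul_le_mul_of_nonneg_left (hwb z) hp)
  calc _ ≤ ∑ x, ∑ y, ∑ m ∈ Finset.range n, (N ^ (m + 2)) x y := by
        refine Finset.sum_le_sum fun x _ => Finset.sum_le_sum fun y _ => ?_
        refine law_exists_pathAvoiding_le (w := w) (p := p) hN (fun x y hx hy => ?_) 2 x y
        simp [N, hx, hy]
    _ = ∑ m ∈ Finset.range n, ∑ x, ∑ y, (N ^ (m + 2)) x y := by
        rw [Finset.sum_comm]
        simp_rw [Finset.sum_comm (s := Finset.range n) (t := Finset.univ)]
        rw [Finset.sum_comm]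
    _ ≤ ∑ m ∈ Finset.range (n + 1), ∑ z, u z * ∑ z', (N ^ m) z z' * u z' := by
        refine (Finset.sum_le_sum fun m _ => sum_sum_pow_add_two_le hN hNsymm hrow m).trans ?_
        refine Finset.sum_le_sum_of_subset_of_nonneg (Finset.range_mono (Nat.le_succ n)) ?_
        exact fun m _ _ => Finset.sum_nonneg fun z _ => mul_nonneg (hu0 z)
          (Finset.sum_nonneg fun z' _ => mul_nonneg (pow_entry_nonneg hN _ _ _) (hu0 z'))
    _ = ∑ z, u z * u z + ∑ z, u z *
          ∑ m ∈ Finset.range n, ∑ z', (N ^ (m + 1)) z z' * u z' := by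
        rw [Finset.sum_range_succ', add_comm]
        congr 1
        · simp [Matrix.one_apply]
        · rw [Finset.sum_comm]
          simp only [Finset.mul_sum]
    _ ≤ ∑ z, (p : ℝ) ^ 2 * (if z ∈ A then 0 else w z ^ 2) +
          ∑ z, (p * w z) * (p * b * (2 * ρ * h z)) := by
        refine add_le_add (Finset.sum_le_sum fun z _ => ?_) (Finset.sum_le_sum fun z _ => ?_)
        · simp only [u]
          split_ifs
          · simp
          · exact le_of_eq (by ring)
        · refine mul_le_mul (huw z) ?_ ?_ (mul_nonneg hp (hw z))
          · calc _ ≤ ∑ m ∈ Finset.range n, ∑ z', (N ^ (m + 1)) z z' * (p * (b * h z')) :=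
                  Finset.sum_le_sum fun m _ => Finset.sum_le_sum fun z' _ =>
                    mul_le_mul_of_nonneg_left (hub z') (pow_entry_nonneg hN _ _ _)
              _ = p * b * ∑ m ∈ Finset.range n, ∑ z', (N ^ (m + 1)) z z' * h z' := by
                  simp only [Finset.mul_sum]
                  exact Finset.sum_congr rfl fun m _ => Finset.sum_congr rfl fun z _ => by ring
              _ ≤ _ := mul_le_mul_of_nonneg_left (sum_range_sum_pow_mul_le hN hρ hρ2
                  (fun x => (hh x).le) hNh n z) (mul_nonneg hp hb)
          · exact Finset.sum_nonneg fun m _ => Finset.sum_nonneg fun z' _ =>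
              mul_nonneg (pow_entry_nonneg hN _ _ _) (hu0 z')
    _ = _ := by
        rw [← Finset.mul_sum, mul_add]
        congr 1
        simp only [Finset.mul_sum]
        exact Finset.sum_congr rfl fun z _ => by ring

end PathSums

/-- Markov's inequality for a weighted number of occurring events. -/
theorem law_le_sum_indicator_le {ι : Type*} [Fintype ι] {c : ι → ℝ} (hc : ∀ j, 0 ≤ c j)
    (E : ι → Set (Config n)) {t : ℝ} (ht : 0 < t) :
    (law w p).real {ω | t ≤ ∑ j, c j * (E j).indicator 1 ω} ≤
      (∑ j, c j * (law w p).real (E j)) / t := by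
  have h := mul_meas_ge_le_integral_of_nonneg (μ := law w p)
    (f := fun ω => ∑ j, c j * (E j).indicator (1 : Config n → ℝ) ω)
    (Eventually.of_forall fun ω => Finset.sum_nonneg fun j _ => mul_nonneg (hc j)
      (Set.indicator_nonneg (fun _ _ => zero_le_one) _)) (Integrable.of_finite) t
  rw [le_div_iff₀ ht, mul_comm]
  refine h.trans (le_of_eq ?_)
  rw [integral_finsetSum _ fun _ _ => Integrable.of_finite]
  refine Finset.sum_congr rfl fun j _ => ?_
  rw [integral_const_mul, integral_indicator_one (Set.toFinite _).measurableSet]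

open Classical in
/-- Chebyshev's inequality for the degree; the variance of a sum of independent indicators is at
most its mean. -/
theorem law_degree_deviation_le (hw : ∀ x, 0 ≤ w x) (x : Fin n) {t : ℝ} (ht : 0 < t) :
    (law w p).real {ω | t ≤ |((Finset.univ.filter fun y => (percGraph ω).Adj x y).card : ℝ) -
        ∑ y ∈ Finset.univ.erase x, adjProb w p x y|} ≤ p * w x / t ^ 2 := by
  set X : Fin n → Config n → ℝ := fun y => {ω | isOpen s(x, y) ω = true}.indicator 1
  have hfin : ∀ f : Config n → ℝ, MemLp f 2 (law w p) := fun f => MemLp.of_discrete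
  have hX1 : ∀ y, (law w p)[X y] = adjProb w p x y := by
    intro y
    rw [integral_indicator_one (Set.toFinite _).measurableSet, law_isOpen]
    rfl
  have hdeg : ∀ ω : Config n, ((Finset.univ.filter fun y => (percGraph ω).Adj x y).card : ℝ) =
      (∑ y ∈ Finset.univ.erase x, X y) ω := by
    intro ω
    have : (Finset.univ.filter fun y => (percGraph ω).Adj x y) =
        (Finset.univ.erase x).filter fun y => isOpen s(x, y) ω = true := by
      ext y; simp [percGraph_adj, ne_comm]
    rw [this, Finset.sum_apply, Finset.card_filter]
    push_cast
    exact Finset.sum_congr rfl fun y _ => by simp [X, Set.indicator_apply]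
  have hmean : (law w p)[∑ y ∈ Finset.univ.erase x, X y] =
      ∑ y ∈ Finset.univ.erase x, adjProb w p x y := by
    simp only [Finset.sum_apply]
    rw [integral_finsetSum _ fun _ _ => Integrable.of_finite]
    exact Finset.sum_congr rfl fun y _ => hX1 y
  have hvar : Var[∑ y ∈ Finset.univ.erase x, X y; law w p] ≤ p * w x := by
    rw [IndepFun.variance_sum (fun _ _ => hfin _)]
    · calc _ ≤ ∑ y ∈ Finset.univ.erase x, adjProb w p x y := by
            refine Finset.sum_le_sum fun y _ => ?_
            refine (variance_le_expectation_sq (hfin _).aestronglyMeasurable).trans (le_of_eq ?_)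
            rw [← hX1]
            congr 1
            ext ω
            simp only [X, Pi.pow_apply, Set.indicator_apply]
            split_ifs <;> simp
        _ ≤ ∑ y, adjProb w p x y := Finset.sum_le_sum_of_subset_of_nonneg
            (Finset.subset_univ _) fun y _ _ => adjProb_nonneg x y
        _ ≤ _ := sum_adjProb_le hw x
    · intro y _ z _ hyz
      have hne : s(x, y) ≠ s(x, z) := fun h => hyz (Sym2.congr_right.1 h)
      have := ((iIndepFun_isOpen w p).indepFun hne).comp
        (φ := fun b : Bool => if b = true then (1 : ℝ) else 0)
        (ψ := fun b : Bool => if b = true then (1 : ℝ) else 0)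
        (measurable_of_finite _) (measurable_of_finite _)
      have hXeq : ∀ y, X y = (fun b : Bool => if b = true then (1 : ℝ) else 0) ∘
          isOpen s(x, y) := fun y => by ext ω; simp [X, Set.indicator_apply]
      change IndepFun (X y) (X z) _
      rw [hXeq y, hXeq z]
      exact this
  have h := meas_ge_le_variance_div_sq (hfin (∑ y ∈ Finset.univ.erase x, X y)) ht
  rw [hmean] at h
  simp only [hdeg]
  have h2 := ENNReal.toReal_mono ENNReal.ofReal_ne_top h
  rw [ENNReal.toReal_ofReal (div_nonneg (variance_nonneg _ _) (sq_nonneg _))] at h2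
  exact h2.trans (div_le_div_of_nonneg_right hvar (sq_nonneg _))

end NorrosReittu

/-! ### Estimates for the scale-free weights -/

namespace NorrosReittu

variable {τ C : ℝ} {n : ℕ}

/-- The weights as a function on the vertex set. -/
noncomputable def vertexWeight (τ C : ℝ) (n : ℕ) (v : Fin n) : ℝ := weight τ C n (v + 1)

/-- The test function `k^{-1/2}`, an approximate eigenvector of the connection probabilities. -/
noncomputable def testFun {n : ℕ} (v : Fin n) : ℝ := ((v : ℝ) + 1) ^ (-(1 / 2) : ℝ)

/-- The factor by which the matrix of connection probabilities multiplies `k^{-1/2}`, at most. It is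
of order `p n^{(3-τ)/2}`. -/
noncomputable def growthRate (τ C : ℝ) (n : ℕ) (p : ℝ) : ℝ :=
  p * ((2 + 2 ^ (alpha τ + 1 / 2) / (alpha τ + 1 / 2 - 1)) *
    (cF τ C * (n : ℝ) ^ (2 * alpha τ - 1)) ^ (1 / (2 * alpha τ)))

theorem half_lt_alpha (hτ2 : 2 < τ) (hτ3 : τ < 3) : 1 / 2 < alpha τ := by
  unfold alpha
  exact one_div_lt_one_div_of_lt (by linarith) (by linarith)

theorem alpha_lt_one (hτ2 : 2 < τ) : alpha τ < 1 := by
  unfold alpha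
  rw [div_lt_one (by linarith)]
  linarith

theorem cF_pos (hC : 0 < C) : 0 < cF τ C := Real.rpow_pos_of_pos hC _

theorem testFun_pos (v : Fin n) : 0 < testFun v := by unfold testFun; positivity

theorem testFun_le_one (v : Fin n) : testFun v ≤ 1 :=
  Real.rpow_le_one_of_one_le_of_nonpos (by linarith [Nat.cast_nonneg (α := ℝ) (v : ℕ)])
    (by norm_num)

theorem vertexWeight_eq (hτ2 : 2 < τ) (hC : 0 < C) (v : Fin n) :
    vertexWeight τ C n v = cF τ C * (n : ℝ) ^ alpha τ * ((v : ℝ) + 1) ^ (-alpha τ) := by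
  have hn : (0 : ℝ) < n := by exact_mod_cast v.pos
  have h := weight_scaling (τ := τ) (by linarith) hC (n := n) (i := v + 1) (by omega) v.isLt
  rw [Real.rpow_neg hn.le, inv_mul_eq_iff_eq_mul₀ (Real.rpow_pos_of_pos hn _).ne'] at h
  rw [vertexWeight, h]
  push_cast
  ring

theorem vertexWeight_nonneg (hτ2 : 2 < τ) (hC : 0 < C) (v : Fin n) :
    0 ≤ vertexWeight τ C n v := by
  rw [vertexWeight_eq hτ2 hC]
  have := cF_pos (τ := τ) hC
  positivity

theorem vertexWeight_le (hτ2 : 2 < τ) (hτ3 : τ < 3) (hC : 0 < C) (v : Fin n) :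
    vertexWeight τ C n v ≤ cF τ C * (n : ℝ) ^ alpha τ * testFun v := by
  rw [vertexWeight_eq hτ2 hC]
  have := cF_pos (τ := τ) hC
  refine mul_le_mul_of_nonneg_left ?_ (by positivity)
  exact Real.rpow_le_rpow_of_exponent_le (by linarith [Nat.cast_nonneg (α := ℝ) (v : ℕ)])
    (by linarith [half_lt_alpha hτ2 hτ3])

theorem cF_mul_le_sum_vertexWeight (hτ2 : 2 < τ) (hC : 0 < C) :
    cF τ C * n ≤ ∑ v, vertexWeight τ C n v := by
  have hc := cF_pos (τ := τ) hC
  have hα : 0 < alpha τ := by unfold alpha; exact one_div_pos.2 (by linarith)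
  have h : ∀ v : Fin n, cF τ C ≤ vertexWeight τ C n v := by
    intro v
    rw [vertexWeight_eq hτ2 hC, mul_assoc]
    refine le_mul_of_one_le_right hc.le ?_
    rw [Real.rpow_neg (by positivity), ← div_eq_mul_inv,
      one_le_div (Real.rpow_pos_of_pos (by positivity) _)]
    exact Real.rpow_le_rpow (by positivity) (by exact_mod_cast v.isLt) hα.le
  calc cF τ C * n = ∑ _v : Fin n, cF τ C := by simp [mul_comm]
    _ ≤ _ := Finset.sum_le_sum fun v _ => h v

theorem weight_mul_div_le (hτ2 : 2 < τ) (hC : 0 < C) (x y : Fin n) :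
    vertexWeight τ C n x * vertexWeight τ C n y / ∑ k, vertexWeight τ C n k ≤
      cF τ C * (n : ℝ) ^ (2 * alpha τ - 1) * ((x : ℝ) + 1) ^ (-alpha τ) *
        ((y : ℝ) + 1) ^ (-alpha τ) := by
  have hc := cF_pos (τ := τ) hC
  have hn : (0 : ℝ) < n := by exact_mod_cast x.pos
  have hℓ : 0 < cF τ C * n := by positivity
  have hw := vertexWeight_nonneg (n := n) hτ2 hC
  calc _ ≤ vertexWeight τ C n x * vertexWeight τ C n y / (cF τ C * n) :=
        div_le_div_of_nonneg_left (mul_nonneg (hw x) (hw y)) hℓ (cF_mul_le_sum_vertexWeight hτ2 hC)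
    _ = _ := by
        rw [vertexWeight_eq hτ2 hC, vertexWeight_eq hτ2 hC, div_eq_iff hℓ.ne',
          show 2 * alpha τ - 1 = alpha τ + alpha τ - 1 by ring, Real.rpow_sub hn,
          Real.rpow_add hn, Real.rpow_one]
        field_simp

theorem sum_adjProb_mul_testFun_le (hτ2 : 2 < τ) (hτ3 : τ < 3) (hC : 0 < C) (p : unitInterval)
    (x : Fin n) :
    ∑ y, adjProb (vertexWeight τ C n) p x y * testFun y ≤ growthRate τ C n p * testFun x := by
  have hc := cF_pos (τ := τ) hC
  have hn : (0 : ℝ) < n := by exact_mod_cast x.pos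
  have hα := half_lt_alpha hτ2 hτ3
  have hx : (0 : ℝ) < (x : ℝ) + 1 := by positivity
  set D := cF τ C * (n : ℝ) ^ (2 * alpha τ - 1)
  have hD : 0 < D := by positivity
  -- the scale below which the connection probability with `x` is of order one
  set Y := D ^ (1 / alpha τ) / ((x : ℝ) + 1)
  have hY : 0 < Y := by positivity
  have hYα : Y ^ alpha τ = D * ((x : ℝ) + 1) ^ (-alpha τ) := by
    rw [Real.div_rpow (by positivity) hx.le, ← Real.rpow_mul hD.le,
      one_div_mul_cancel (by linarith), Real.rpow_one, Real.rpow_neg hx.le, div_eq_mul_inv]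
  have hYhalf : Y ^ (1 / 2 : ℝ) = D ^ (1 / (2 * alpha τ)) * testFun x := by
    rw [Real.div_rpow (by positivity) hx.le, ← Real.rpow_mul hD.le, testFun,
      Real.rpow_neg hx.le, div_eq_mul_inv]
    congr 2
    field_simp
  have hle : ∀ y : Fin n, (edgeProb (vertexWeight τ C n) s(x, y) : ℝ) ≤
      min 1 ((Y / ((y : ℝ) + 1)) ^ alpha τ) := by
    intro y
    have hy : (0 : ℝ) < (y : ℝ) + 1 := by positivity
    refine le_min (edgeProb _ _).2.2 ((edgeProb_le (vertexWeight_nonneg hτ2 hC) x y).trans ?_)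
    rw [Real.div_rpow hY.le hy.le, hYα, div_eq_mul_inv _ (((y : ℝ) + 1) ^ alpha τ),
      ← Real.rpow_neg hy.le]
    exact weight_mul_div_le hτ2 hC x y
  calc _ = p * ∑ y, edgeProb (vertexWeight τ C n) s(x, y) * testFun y := by
        simp only [adjProb, Matrix.of_apply, Finset.mul_sum, mul_assoc]
    _ ≤ p * ∑ y : Fin n, min 1 ((Y / ((y : ℝ) + 1)) ^ alpha τ) *
          ((y : ℝ) + 1) ^ (-(1 / 2) : ℝ) :=
        mul_le_mul_of_nonneg_left (Finset.sum_le_sum fun y _ =>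
          mul_le_mul_of_nonneg_right (hle y) (testFun_pos y).le) p.2.1
    _ ≤ p * ((2 + 2 ^ (alpha τ + 1 / 2) / (alpha τ + 1 / 2 - 1)) * Y ^ (1 / 2 : ℝ)) := by
        refine mul_le_mul_of_nonneg_left ?_ p.2.1
        rw [Fin.sum_univ_eq_sum_range (fun k => min 1 ((Y / ((k : ℝ) + 1)) ^ alpha τ) *
          ((k : ℝ) + 1) ^ (-(1 / 2) : ℝ)) n]
        exact sum_min_one_rpow_mul_le hα hY n
    _ = _ := by rw [hYhalf, growthRate]; ring

theorem growthRate_nonneg (hτ2 : 2 < τ) (hτ3 : τ < 3) (hC : 0 < C) (p : unitInterval) :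
    0 ≤ growthRate τ C n p := by
  have hc := cF_pos (τ := τ) hC
  have h1 : 0 < alpha τ + 1 / 2 - 1 := by linarith [half_lt_alpha hτ2 hτ3]
  have := p.2.1
  unfold growthRate
  positivity

theorem growthRate_eq (hτ2 : 2 < τ) (hC : 0 < C) (l : ℝ) (hn : 0 < n) :
    growthRate τ C n (l * (n : ℝ) ^ (-((3 - τ) / 2))) =
      l * ((2 + 2 ^ (alpha τ + 1 / 2) / (alpha τ + 1 / 2 - 1)) *
        cF τ C ^ (1 / (2 * alpha τ))) := by
  have hc := cF_pos (τ := τ) hC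
  have hn' : (0 : ℝ) < n := by exact_mod_cast hn
  have ht : τ - 1 ≠ 0 := by linarith
  have e : (2 * alpha τ - 1) * (1 / (2 * alpha τ)) = (3 - τ) / 2 := by
    unfold alpha; field_simp; ring
  have e2 : (n : ℝ) ^ (-((3 - τ) / 2)) * (n : ℝ) ^ ((3 - τ) / 2) = 1 := by
    rw [← Real.rpow_add hn']; simp
  rw [growthRate, Real.mul_rpow hc.le (by positivity), ← Real.rpow_mul hn'.le, e]
  linear_combination (l * ((2 + 2 ^ (alpha τ + 1 / 2) / (alpha τ + 1 / 2 - 1)) *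
        cF τ C ^ (1 / (2 * alpha τ)))) * e2

/-- The expected degree of `x` is `p w_x` up to an error of order `p n^{1-(1-α)q}`,
where `q = (1 + 1/α)/2`; the exponent is smaller than `α` since `q > 1`, and the sum of the
`q`-th powers of the weights is of order `n` since `α q < 1`. -/
theorem le_sum_adjProb_erase (hτ2 : 2 < τ) (hτ3 : τ < 3) (hC : 0 < C) (p : unitInterval)
    (x : Fin n) :
    p * (vertexWeight τ C n x - (1 + cF τ C ^ ((1 + 1 / alpha τ) / 2) / (1 - (alpha τ + 1) / 2) *
      (n : ℝ) ^ (1 + (alpha τ - 1) * ((1 + 1 / alpha τ) / 2)))) ≤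
      ∑ y ∈ Finset.univ.erase x, adjProb (vertexWeight τ C n) p x y := by
  have hc := cF_pos (τ := τ) hC
  have hn : (0 : ℝ) < n := by exact_mod_cast x.pos
  have hα := half_lt_alpha hτ2 hτ3
  have hα1 := alpha_lt_one hτ2
  have hα0 : 0 < alpha τ := by linarith
  have hw := vertexWeight_nonneg (n := n) hτ2 hC
  set w := vertexWeight τ C n
  set α := alpha τ
  set q := (1 + 1 / α) / 2 with hq
  have hinv : 1 < 1 / α := by rw [lt_div_iff₀ hα0]; linarith
  have hinv2 : 1 / α < 2 := by rw [div_lt_iff₀ hα0]; linarith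
  have hαq : α * q = (α + 1) / 2 := by rw [hq]; field_simp
  have hq0 : 0 < q := by rw [hq]; positivity
  have hℓ : 0 < ∑ k, w k := lt_of_lt_of_le (by positivity) (cF_mul_le_sum_vertexWeight hτ2 hC)
  have hx0 : ∀ y, 0 ≤ w x * w y / ∑ k, w k := fun y =>
    div_nonneg (mul_nonneg (hw x) (hw y)) hℓ.le
  have h1 : ∑ y, (w x * w y / ∑ k, w k) = w x := by
    rw [← Finset.sum_div, ← Finset.mul_sum, mul_div_assoc, div_self hℓ.ne', mul_one]
  have h2 : ∑ y, (w x * w y / ∑ k, w k) ^ q ≤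
      cF τ C ^ q / (1 - (α + 1) / 2) * (n : ℝ) ^ (1 + (α - 1) * q) := by
    calc _ ≤ ∑ y : Fin n, (cF τ C * (n : ℝ) ^ (2 * α - 1)) ^ q * ((y : ℝ) + 1) ^ (-(α * q)) := by
          refine Finset.sum_le_sum fun y _ => ?_
          have hy : (0 : ℝ) < (y : ℝ) + 1 := by positivity
          rw [← neg_mul, Real.rpow_mul hy.le, ← Real.mul_rpow (by positivity) (by positivity)]
          refine Real.rpow_le_rpow (hx0 y) ((weight_mul_div_le hτ2 hC x y).trans ?_) hq0.le
          refine mul_le_mul_of_nonneg_right (mul_le_of_le_one_right (by positivity) ?_)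
            (by positivity)
          exact Real.rpow_le_one_of_one_le_of_nonpos
            (by linarith [Nat.cast_nonneg (α := ℝ) (x : ℕ)]) (by linarith)
      _ ≤ (cF τ C * (n : ℝ) ^ (2 * α - 1)) ^ q * ((n : ℝ) ^ (1 - α * q) / (1 - α * q)) := by
          rw [← Finset.mul_sum, Fin.sum_univ_eq_sum_range (fun k => ((k : ℝ) + 1) ^ (-(α * q))) n]
          refine mul_le_mul_of_nonneg_left (sum_rpow_neg_le (by positivity) ?_ n) (by positivity)
          rw [hαq]; linarith
      _ = cF τ C ^ q / (1 - α * q) * ((n : ℝ) ^ ((2 * α - 1) * q) * (n : ℝ) ^ (1 - α * q)) := by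
          rw [Real.mul_rpow hc.le (by positivity), ← Real.rpow_mul hn.le]; ring
      _ = _ := by
          rw [← Real.rpow_add hn, show (2 * α - 1) * q + (1 - α * q) = 1 + (α - 1) * q by ring,
            hαq]
  have h3 : ∀ y, w x * w y / ∑ k, w k - (w x * w y / ∑ k, w k) ^ q ≤ edgeProb w s(x, y) := by
    intro y
    rw [edgeProb_eq hw]
    exact sub_rpow_le_one_sub_exp_neg (hx0 y) (by rw [hq]; linarith) (by rw [hq]; linarith)
  have h4 := Finset.sum_le_sum fun y (_ : y ∈ Finset.univ) => h3 y
  rw [Finset.sum_sub_distrib, h1, ← Finset.sum_erase_add _ (fun y => (edgeProb w s(x, y) : ℝ))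
    (Finset.mem_univ x)] at h4
  have h5 : (edgeProb w s(x, x) : ℝ) ≤ 1 := (edgeProb w s(x, x)).2.2
  simp only [adjProb, Matrix.of_apply]
  rw [← Finset.mul_sum]
  refine mul_le_mul_of_nonneg_left ?_ p.2.1
  linarith

open Classical in
theorem sum_sq_vertexWeight_le (hτ2 : 2 < τ) (hτ3 : τ < 3) (hC : 0 < C) (K : ℕ) :
    ∑ z : Fin n, (if z ∈ {v : Fin n | (v : ℕ) < K} then 0 else vertexWeight τ C n z ^ 2) ≤
      (cF τ C * (n : ℝ) ^ alpha τ) ^ 2 *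
        (2 ^ (2 * alpha τ) / (2 * alpha τ - 1) * ((K : ℝ) + 1) ^ (1 - 2 * alpha τ)) := by
  have hα := half_lt_alpha hτ2 hτ3
  calc _ = ∑ z : Fin n, if (z : ℕ) < K then 0 else
          (cF τ C * (n : ℝ) ^ alpha τ) ^ 2 * ((z : ℝ) + 1) ^ (-(2 * alpha τ)) := by
        refine Finset.sum_congr rfl fun z _ => ?_
        simp only [Set.mem_ofPred_eq]
        split_ifs
        · rfl
        · have hz : (0 : ℝ) < (z : ℝ) + 1 := by positivity
          rw [vertexWeight_eq hτ2 hC, mul_pow _ (((z : ℝ) + 1) ^ (-alpha τ)),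
            ← Real.rpow_natCast (((z : ℝ) + 1) ^ (-alpha τ)), ← Real.rpow_mul hz.le]
          congr 2
          push_cast
          ring
    _ = ∑ k ∈ Finset.range n, if k < K then 0 else
          (cF τ C * (n : ℝ) ^ alpha τ) ^ 2 * ((k : ℝ) + 1) ^ (-(2 * alpha τ)) :=
        Fin.sum_univ_eq_sum_range (fun k => if k < K then 0 else
          (cF τ C * (n : ℝ) ^ alpha τ) ^ 2 * ((k : ℝ) + 1) ^ (-(2 * alpha τ))) n
    _ = ∑ k ∈ Finset.Ico K n,
          (cF τ C * (n : ℝ) ^ alpha τ) ^ 2 * ((k : ℝ) + 1) ^ (-(2 * alpha τ)) := by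
        simp_rw [← ite_not (_ < K) _ (0 : ℝ)]
        rw [← Finset.sum_filter]
        congr 1
        ext k
        simp only [Finset.mem_filter, Finset.mem_range, Finset.mem_Ico]
        omega
    _ ≤ _ := by
        rw [← Finset.mul_sum]
        exact mul_le_mul_of_nonneg_left (sum_Ico_rpow_neg_le (by linarith) K n) (sq_nonneg _)

theorem sum_vertexWeight_mul_testFun_le (hτ2 : 2 < τ) (hτ3 : τ < 3) (hC : 0 < C) :
    ∑ z : Fin n, vertexWeight τ C n z * testFun z ≤
      cF τ C * (n : ℝ) ^ alpha τ * (2 ^ (alpha τ + 1 / 2) / (alpha τ + 1 / 2 - 1)) := by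
  have hα := half_lt_alpha hτ2 hτ3
  have hc := cF_pos (τ := τ) hC
  calc _ = ∑ z : Fin n, cF τ C * (n : ℝ) ^ alpha τ * ((z : ℝ) + 1) ^ (-(alpha τ + 1 / 2)) := by
        refine Finset.sum_congr rfl fun z _ => ?_
        have hz : (0 : ℝ) < (z : ℝ) + 1 := by positivity
        rw [vertexWeight_eq hτ2 hC, testFun, mul_assoc, ← Real.rpow_add hz, neg_add]
    _ = ∑ k ∈ Finset.Ico 0 n, cF τ C * (n : ℝ) ^ alpha τ *
          ((k : ℝ) + 1) ^ (-(alpha τ + 1 / 2)) := by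
        rw [← Finset.range_eq_Ico]
        exact Fin.sum_univ_eq_sum_range
          (fun k => cF τ C * (n : ℝ) ^ alpha τ * ((k : ℝ) + 1) ^ (-(alpha τ + 1 / 2))) n
    _ ≤ _ := by
        rw [← Finset.mul_sum]
        refine mul_le_mul_of_nonneg_left ((sum_Ico_rpow_neg_le (by linarith) 0 n).trans ?_)
          (by positivity)
        simp

end NorrosReittu

/-! ### Negligible events -/

/-- The probabilities of the events `B n` tend to zero. -/
def Negligible {Ω : ℕ → Type} [∀ n, MeasurableSpace (Ω n)] (P : ∀ n, Measure (Ω n))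
    (B : ∀ n, Set (Ω n)) : Prop :=
  Tendsto (fun n => (P n).real (B n)) atTop (𝓝 0)

namespace Negligible

variable {Ω : ℕ → Type} [∀ n, MeasurableSpace (Ω n)] {P : ∀ n, Measure (Ω n)}
  {B B' : ∀ n, Set (Ω n)}

theorem of_le {u : ℕ → ℝ} (hu : Tendsto u atTop (𝓝 0)) (h : ∀ᶠ n in atTop, (P n).real (B n) ≤ u n) :
    Negligible P B :=
  squeeze_zero' (Eventually.of_forall fun _ => measureReal_nonneg) h hu

theorem mono [∀ n, IsProbabilityMeasure (P n)] (h : Negligible P B)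
    (hsub : ∀ᶠ n in atTop, B' n ⊆ B n) : Negligible P B' :=
  of_le h (hsub.mono fun _ hn => measureReal_mono hn)

theorem union (h : Negligible P B) (h' : Negligible P B') :
    Negligible P fun n => B n ∪ B' n := by
  have := Tendsto.add h h'
  rw [add_zero] at this
  exact of_le this (Eventually.of_forall fun n => measureReal_union_le _ _)

theorem biUnion {ι : Type*} (s : Finset ι) {E : ι → ∀ n, Set (Ω n)}
    (h : ∀ j ∈ s, Negligible P (E j)) : Negligible P fun n => ⋃ j ∈ s, E j n := by
  have := tendsto_finsetSum s h
  rw [Finset.sum_const_zero] at this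
  exact of_le this (Eventually.of_forall fun n => measureReal_biUnion_finset_le _ _)

variable [∀ n, IsProbabilityMeasure (P n)]

theorem tendsto_measure (h : Negligible P B) : Tendsto (fun n => P n (B n)) atTop (𝓝 0) := by
  rw [← ENNReal.tendsto_toReal_iff (fun n => measure_ne_top _ _) ENNReal.zero_ne_top]
  exact h

theorem tendstoInProb {X : ∀ n, Ω n → ℝ} {c : ℝ}
    (h : ∀ ε, 0 < ε → Negligible P fun n => {ω | ε ≤ |X n ω - c|}) :
    NorrosReittu.TendstoInProb P X c :=
  fun ε hε => (h ε hε).tendsto_measure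

theorem whp [∀ n, DiscreteMeasurableSpace (Ω n)] (h : Negligible P fun n => (B n)ᶜ) :
    NorrosReittu.WHP P B := by
  have h1 := ENNReal.Tendsto.sub (tendsto_const_nhds (x := (1 : ENNReal))) h.tendsto_measure
    (Or.inl ENNReal.one_ne_top)
  rw [tsub_zero] at h1
  refine h1.congr fun n => ?_
  rw [← prob_compl_eq_one_sub (MeasurableSet.of_discrete), compl_compl]

end Negligible

/-! ### The components of the hubs -/

namespace NorrosReittu

variable {τ C : ℝ} {π : ℕ → unitInterval}

/-- The laws of the percolated scale-free graphs. -/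
noncomputable def percLaw (τ C : ℝ) (π : ℕ → unitInterval) (n : ℕ) : Measure (Config n) :=
  law (vertexWeight τ C n) (π n)

instance isProbabilityMeasure_percLaw (n : ℕ) : IsProbabilityMeasure (percLaw τ C π n) := by
  unfold percLaw; infer_instance

/-- The parameter range of the theorem, in the form in which it is used: the percolated graph is
subcritical (`growthRate → 0`), and the order `n^α π_n` of the degrees of the hubs diverges. -/
structure Regime (τ C : ℝ) (π : ℕ → unitInterval) : Prop where
  two_lt : 2 < τ
  lt_three : τ < 3
  const_pos : 0 < C
  growthRate_tendsto : Tendsto (fun n => growthRate τ C n (π n)) atTop (𝓝 0)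
  scale_tendsto : Tendsto (fun n : ℕ => (n : ℝ) ^ alpha τ * (π n : ℝ)) atTop atTop

theorem negligible_of_hub {i : ℕ} (hi : 1 ≤ i) {E : ∀ n, Fin n → Set (Config n)} {u : ℕ → ℝ}
    (hu : Tendsto u atTop (𝓝 0))
    (h : ∀ᶠ n in atTop, ∀ x : Fin n, (x : ℕ) + 1 = i → (percLaw τ C π n).real (E n x) ≤ u n) :
    Negligible (percLaw τ C π) fun n => {ω | ∃ x : Fin n, (x : ℕ) + 1 = i ∧ ω ∈ E n x} := by
  refine Negligible.of_le hu ?_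
  filter_upwards [h, eventually_ge_atTop i] with n hn hni
  have hlt : i - 1 < n := by omega
  refine (measureReal_mono ?_).trans (hn ⟨i - 1, hlt⟩ (Nat.sub_add_cancel hi))
  rintro ω ⟨x, hx, hω⟩
  have : x = ⟨i - 1, hlt⟩ := Fin.ext (Nat.eq_sub_of_add_eq hx)
  rwa [← this]

namespace Regime

variable (R : Regime τ C π)

include R

theorem eventually_growthRate_le : ∀ᶠ n in atTop, growthRate τ C n (π n) ≤ 1 / 2 :=
  R.growthRate_tendsto.eventually_le_const (by norm_num)

theorem eventually_scale_pos : ∀ᶠ n : ℕ in atTop, 0 < (n : ℝ) ^ alpha τ * (π n : ℝ) :=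
  R.scale_tendsto.eventually_gt_atTop 0

theorem limit_growthRate (c : ℝ) :
    Tendsto (fun n => c * growthRate τ C n (π n)) atTop (𝓝 0) := by
  simpa using R.growthRate_tendsto.const_mul c

open Classical in
/-- The vertices of the component of a hub that are not its neighbours are reached by a path of
length at least two, and there are few such vertices. -/
theorem negligible_longPath {i : ℕ} (hi : 1 ≤ i) {ε : ℝ} (hε : 0 < ε) :
    Negligible (percLaw τ C π) fun n => {ω | ∃ x : Fin n, (x : ℕ) + 1 = i ∧
      ω ∈ {ω | ε * ((n : ℝ) ^ alpha τ * π n) ≤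
        ((Finset.univ.filter fun y => LongPath (percGraph ω) ∅ x y).card : ℝ)}} := by
  have hc := cF_pos (τ := τ) R.const_pos
  refine negligible_of_hub hi (R.limit_growthRate (2 * cF τ C / ε)) ?_
  filter_upwards [R.eventually_growthRate_le, R.eventually_scale_pos] with n hρ ha x _
  have hρ0 := growthRate_nonneg (n := n) R.two_lt R.lt_three R.const_pos (π n)
  have h1 := law_le_sum_indicator_le (w := vertexWeight τ C n) (p := π n) (c := fun _ : Fin n => 1)
    (fun _ => zero_le_one) (fun y => {ω | LongPath (percGraph ω) ∅ x y}) (mul_pos hε ha)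
  have h2 := sum_law_longPath_le hρ0 hρ testFun_pos
    (sum_adjProb_mul_testFun_le R.two_lt R.lt_three R.const_pos (π n))
    (vertexWeight_nonneg R.two_lt R.const_pos) (by positivity)
    (vertexWeight_le R.two_lt R.lt_three R.const_pos) x
  have hset : ∀ ω : Config n,
      ((Finset.univ.filter fun y => LongPath (percGraph ω) ∅ x y).card : ℝ) =
        ∑ y, 1 * {ω | LongPath (percGraph ω) ∅ x y}.indicator 1 ω := by
    intro ω
    rw [Finset.card_filter]
    push_cast
    exact Finset.sum_congr rfl fun y _ => by simp [Set.indicator_apply]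
  simp only [hset]
  refine h1.trans ?_
  simp only [one_mul]
  rw [div_le_iff₀ (mul_pos hε ha)]
  refine h2.trans ?_
  have e : 2 * cF τ C / ε * growthRate τ C n (π n) * (ε * ((n : ℝ) ^ alpha τ * π n)) =
      π n * (2 * growthRate τ C n (π n) * (cF τ C * (n : ℝ) ^ alpha τ) * 1) := by
    field_simp
  rw [e]
  have := (π n).2.1
  gcongr
  exact testFun_le_one x

/-- Apart from the hub itself, the component of a hub has negligible weight. -/
theorem negligible_weight {i : ℕ} (hi : 1 ≤ i) {ε : ℝ} (hε : 0 < ε) :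
    Negligible (percLaw τ C π) fun n => {ω | ∃ x : Fin n, (x : ℕ) + 1 = i ∧
      ω ∈ {ω | ε * (n : ℝ) ^ alpha τ ≤
        ∑ y ∈ (component (percGraph ω) x).erase x, vertexWeight τ C n y}} := by
  classical
  have hc := cF_pos (τ := τ) R.const_pos
  refine negligible_of_hub hi (R.limit_growthRate (2 * cF τ C / ε)) ?_
  filter_upwards [R.eventually_growthRate_le, eventually_gt_atTop 0] with n hρ hn x _
  have hρ0 := growthRate_nonneg (n := n) R.two_lt R.lt_three R.const_pos (π n)
  have hn' : (0 : ℝ) < n := by exact_mod_cast hn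
  have ht : 0 < ε * (n : ℝ) ^ alpha τ := by positivity
  have h1 := law_le_sum_indicator_le (w := vertexWeight τ C n) (p := π n)
    (c := vertexWeight τ C n) (vertexWeight_nonneg R.two_lt R.const_pos)
    (fun y => {ω | (percGraph ω).Reachable x y ∧ x ≠ y}) ht
  have h2 := sum_law_reachable_mul_le hρ0 hρ testFun_pos
    (sum_adjProb_mul_testFun_le R.two_lt R.lt_three R.const_pos (π n))
    (by positivity) (vertexWeight_le R.two_lt R.lt_three R.const_pos) x
  have hset : ∀ ω : Config n,
      ∑ y ∈ (component (percGraph ω) x).erase x, vertexWeight τ C n y =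
        ∑ y, vertexWeight τ C n y *
          {ω | (percGraph ω).Reachable x y ∧ x ≠ y}.indicator 1 ω := by
    intro ω
    have : (component (percGraph ω) x).erase x =
        Finset.univ.filter fun y => (percGraph ω).Reachable x y ∧ x ≠ y := by
      ext y; simp [and_comm, ne_comm]
    rw [this, Finset.sum_filter]
    exact Finset.sum_congr rfl fun y _ => by simp [Set.indicator_apply]
  simp only [hset]
  refine h1.trans ?_
  rw [div_le_iff₀ ht]
  refine h2.trans ?_
  have e : 2 * cF τ C / ε * growthRate τ C n (π n) * (ε * (n : ℝ) ^ alpha τ) =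
      2 * growthRate τ C n (π n) * (cF τ C * (n : ℝ) ^ alpha τ) * 1 := by
    field_simp
  rw [e]
  gcongr
  exact testFun_le_one x

/-- Two fixed hubs lie in different components. -/
theorem negligible_reachable {i j : ℕ} (hi : 1 ≤ i) (hij : i ≠ j) :
    Negligible (percLaw τ C π) fun n => {ω | ∃ x : Fin n, (x : ℕ) + 1 = i ∧
      ω ∈ {ω | ∃ y : Fin n, (y : ℕ) + 1 = j ∧ (percGraph ω).Reachable x y}} := by
  refine negligible_of_hub hi (R.limit_growthRate (2 / (j : ℝ) ^ (-(1 / 2) : ℝ))) ?_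
  filter_upwards [R.eventually_growthRate_le] with n hρ x hx
  have hρ0 := growthRate_nonneg (n := n) R.two_lt R.lt_three R.const_pos (π n)
  by_cases hy : ∃ y : Fin n, (y : ℕ) + 1 = j
  · obtain ⟨y, hy⟩ := hy
    have hxy : x ≠ y := by rintro rfl; omega
    have h := law_reachable_le hρ0 hρ testFun_pos
      (sum_adjProb_mul_testFun_le R.two_lt R.lt_three R.const_pos (π n)) hxy
    have hsub : {ω : Config n | ∃ y : Fin n, (y : ℕ) + 1 = j ∧ (percGraph ω).Reachable x y} ⊆
        {ω | (percGraph ω).Reachable x y} := by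
      rintro ω ⟨z, hz, h⟩
      have : z = y := by ext; omega
      exact this ▸ h
    refine (measureReal_mono hsub).trans (h.trans ?_)
    have e : testFun y = (j : ℝ) ^ (-(1 / 2) : ℝ) := by
      rw [testFun, ← hy]; push_cast; rfl
    rw [e, div_mul_eq_mul_div]
    refine div_le_div_of_nonneg_right ?_ (by positivity)
    exact mul_le_of_le_one_right (by positivity) (testFun_le_one x)
  · have : {ω : Config n | ∃ y : Fin n, (y : ℕ) + 1 = j ∧ (percGraph ω).Reachable x y} = ∅ := by
      ext ω
      simp only [Set.mem_ofPred_eq, Set.mem_empty_iff_false, iff_false]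
      rintro ⟨y, hyj, -⟩
      exact hy ⟨y, hyj⟩
    rw [this, measureReal_empty]
    positivity

open Classical in
theorem negligible_degree {i : ℕ} (hi : 1 ≤ i) {ε : ℝ} (hε : 0 < ε) :
    Negligible (percLaw τ C π) fun n => {ω | ∃ x : Fin n, (x : ℕ) + 1 = i ∧
      ω ∈ {ω | ε * ((n : ℝ) ^ alpha τ * π n) ≤
        |((Finset.univ.filter fun y => (percGraph ω).Adj x y).card : ℝ) -
          cF τ C * (i : ℝ) ^ (-alpha τ) * ((n : ℝ) ^ alpha τ * π n)|}} := by
  have hc := cF_pos (τ := τ) R.const_pos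
  have hα := half_lt_alpha R.two_lt R.lt_three
  have hα1 := alpha_lt_one R.two_lt
  set q := (1 + 1 / alpha τ) / 2 with hq
  have hq1 : 1 < q := by
    have : 1 < 1 / alpha τ := by rw [lt_div_iff₀ (by linarith)]; linarith
    rw [hq]; linarith
  -- the error in the expected degree is of smaller order
  have herr : Tendsto (fun n : ℕ => (1 + cF τ C ^ q / (1 - (alpha τ + 1) / 2) *
      (n : ℝ) ^ (1 + (alpha τ - 1) * q)) / (n : ℝ) ^ alpha τ) atTop (𝓝 0) := by
    have t1 : Tendsto (fun n : ℕ => (n : ℝ) ^ (-alpha τ)) atTop (𝓝 0) :=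
      (tendsto_rpow_neg_atTop (by linarith)).comp tendsto_natCast_atTop_atTop
    have t2 : Tendsto (fun n : ℕ => (n : ℝ) ^ (-((1 - alpha τ) * (q - 1)))) atTop (𝓝 0) :=
      (tendsto_rpow_neg_atTop (mul_pos (by linarith) (by linarith))).comp
        tendsto_natCast_atTop_atTop
    have t3 := t1.add (t2.const_mul (cF τ C ^ q / (1 - (alpha τ + 1) / 2)))
    rw [mul_zero, add_zero] at t3
    refine t3.congr' ?_
    filter_upwards [eventually_gt_atTop 0] with n hn
    have hn' : (0 : ℝ) < n := by exact_mod_cast hn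
    have e : -((1 - alpha τ) * (q - 1)) = (1 + (alpha τ - 1) * q) + -alpha τ := by ring
    rw [e, Real.rpow_add hn', Real.rpow_neg hn'.le]
    field_simp
  have hu : Tendsto (fun n : ℕ => 4 * cF τ C / ε ^ 2 * ((n : ℝ) ^ alpha τ * π n)⁻¹) atTop
      (𝓝 0) := by
    simpa using (tendsto_inv_atTop_zero.comp R.scale_tendsto).const_mul (4 * cF τ C / ε ^ 2)
  refine negligible_of_hub hi hu ?_
  filter_upwards [R.eventually_scale_pos, eventually_gt_atTop 0,
    herr.eventually_le_const (half_pos hε)] with n ha hn hsmall x hx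
  have hn' : (0 : ℝ) < n := by exact_mod_cast hn
  have hnα : 0 < (n : ℝ) ^ alpha τ := by positivity
  have hp := (π n).2.1
  have hw := vertexWeight_nonneg (n := n) R.two_lt R.const_pos
  set a := (n : ℝ) ^ alpha τ * (π n : ℝ) with ha_def
  have hwx : vertexWeight τ C n x = cF τ C * (n : ℝ) ^ alpha τ * (i : ℝ) ^ (-alpha τ) := by
    rw [vertexWeight_eq R.two_lt R.const_pos, ← hx]; push_cast; rfl
  have hpw : (π n : ℝ) * vertexWeight τ C n x = cF τ C * (i : ℝ) ^ (-alpha τ) * a := by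
    rw [hwx, ha_def]; ring
  have hlow := le_sum_adjProb_erase R.two_lt R.lt_three R.const_pos (π n) x
  have hup : ∑ y ∈ Finset.univ.erase x, adjProb (vertexWeight τ C n) (π n) x y ≤
      cF τ C * (i : ℝ) ^ (-alpha τ) * a := by
    rw [← hpw]
    exact (Finset.sum_le_sum_of_subset_of_nonneg (Finset.subset_univ _)
      fun y _ _ => adjProb_nonneg x y).trans (sum_adjProb_le hw x)
  rw [div_le_iff₀ hnα] at hsmall
  rw [mul_sub, hpw] at hlow
  have hsm := mul_le_mul_of_nonneg_left hsmall hp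
  have hsm2 : (π n : ℝ) * (ε / 2 * (n : ℝ) ^ alpha τ) = ε / 2 * a := by rw [ha_def]; ring
  rw [hsm2] at hsm
  have hdev := law_degree_deviation_le hw (p := π n) x (mul_pos (half_pos hε) ha)
  refine (measureReal_mono ?_).trans (hdev.trans ?_)
  · intro ω hω
    simp only [Set.mem_ofPred_eq] at hω ⊢
    rw [le_abs] at hω ⊢
    rcases hω with h | h
    · left; linarith
    · right; linarith
  · rw [hpw, div_le_iff₀ (by positivity)]
    have e : 4 * cF τ C / ε ^ 2 * a⁻¹ * (ε / 2 * a) ^ 2 = cF τ C * 1 * a := by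
      field_simp; norm_num
    rw [e]
    gcongr
    exact Real.rpow_le_one_of_one_le_of_nonpos (by exact_mod_cast hi) (by linarith)

/-- The size of the component of a hub is governed by the degree of the hub. -/
theorem negligible_size {i : ℕ} (hi : 1 ≤ i) {ε : ℝ} (hε : 0 < ε) :
    Negligible (percLaw τ C π) fun n => {ω | ∃ x : Fin n, (x : ℕ) + 1 = i ∧
      ε * ((n : ℝ) ^ alpha τ * π n) ≤ |((component (percGraph ω) x).card : ℝ) -
          cF τ C * (i : ℝ) ^ (-alpha τ) * ((n : ℝ) ^ alpha τ * π n)|} := by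
  classical
  have hε3 : 0 < ε / 3 := by positivity
  refine ((R.negligible_longPath hi hε3).union (R.negligible_degree hi hε3)).mono ?_
  filter_upwards [R.scale_tendsto.eventually_gt_atTop (3 / ε)] with n hn
  rintro ω ⟨x, hx, hω⟩
  set a := (n : ℝ) ^ alpha τ * (π n : ℝ)
  rw [div_lt_iff₀ hε] at hn
  by_contra hcon
  simp only [Set.mem_union, Set.mem_ofPred_eq, not_or, not_exists, not_and, not_le] at hcon
  have h1 := hcon.1 x hx
  have h2 := abs_lt.1 (hcon.2 x hx)
  have hsub1 : (Finset.univ.filter fun y => (percGraph ω).Adj x y) ⊆ component (percGraph ω) x := by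
    intro y hy
    simp only [Finset.mem_filter, Finset.mem_univ, true_and] at hy
    exact mem_component.2 hy.reachable
  have hsub2 : component (percGraph ω) x ⊆
      ((Finset.univ.filter fun y => (percGraph ω).Adj x y) ∪
        Finset.univ.filter fun y => LongPath (percGraph ω) ∅ x y) ∪ {x} := by
    intro y hy
    by_cases hxy : x = y
    · simp [hxy]
    by_cases hadj : (percGraph ω).Adj x y
    · simp [hadj]
    have := longPath_of_reachable (A := ∅) (mem_component.1 hy) (by simp) hxy hadj
    simp [this]
  have hcard1 : ((Finset.univ.filter fun y => (percGraph ω).Adj x y).card : ℝ) ≤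
      (component (percGraph ω) x).card := by exact_mod_cast Finset.card_le_card hsub1
  have hcard2 : ((component (percGraph ω) x).card : ℝ) ≤
      (Finset.univ.filter fun y => (percGraph ω).Adj x y).card +
        (Finset.univ.filter fun y => LongPath (percGraph ω) ∅ x y).card + 1 := by
    have := (Finset.card_le_card hsub2).trans ((Finset.card_union_le _ _).trans
      (Nat.add_le_add_right (Finset.card_union_le _ _) _))
    rw [Finset.card_singleton] at this
    exact_mod_cast this
  rcases le_abs.1 hω with h | h
  · linarith
  · linarith

/-! ### Components without hubs -/

open Classical in
/-- Outside the first `K` vertices, with `K` large, there are no components of the order of those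
of the hubs. The expected number of pairs in such components is controlled by the sum
of the squared weights, which is dominated by the hubs because `2 α > 1`. -/
theorem exists_small_components {ε δ : ℝ} (hε : 0 < ε) (hδ : 0 < δ) :
    ∃ K : ℕ, ∀ᶠ n in atTop, (percLaw τ C π n).real {ω | ∃ x : Fin n,
      (∀ v, (percGraph ω).Reachable x v → K ≤ (v : ℕ)) ∧
        ε * ((n : ℝ) ^ alpha τ * π n) ≤ ((component (percGraph ω) x).card : ℝ)} ≤ δ := by
  have hc := cF_pos (τ := τ) R.const_pos
  have hα := half_lt_alpha R.two_lt R.lt_three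
  set S₁ := (2 : ℝ) ^ (2 * alpha τ) / (2 * alpha τ - 1)
  set S₂ := (2 : ℝ) ^ (alpha τ + 1 / 2) / (alpha τ + 1 / 2 - 1)
  obtain ⟨K, hK⟩ : ∃ K : ℕ,
      8 * cF τ C ^ 2 / ε ^ 2 * (S₁ * ((K : ℝ) + 1) ^ (1 - 2 * alpha τ)) ≤ δ / 2 := by
    have t1 : Tendsto (fun K : ℕ => ((K : ℝ) + 1) ^ (1 - 2 * alpha τ)) atTop (𝓝 0) := by
      have t0 := (tendsto_rpow_neg_atTop (y := 2 * alpha τ - 1) (by linarith)).comp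
        (tendsto_natCast_atTop_atTop.atTop_add (tendsto_const_nhds (x := (1 : ℝ))))
      refine t0.congr fun K => ?_
      simp only [Function.comp_apply, neg_sub]
    have t2 := (t1.const_mul S₁).const_mul (8 * cF τ C ^ 2 / ε ^ 2)
    rw [mul_zero, mul_zero] at t2
    exact (t2.eventually_le_const (half_pos hδ)).exists
  refine ⟨K, ?_⟩
  filter_upwards [R.eventually_growthRate_le, R.scale_tendsto.eventually_ge_atTop (8 / ε),
    R.eventually_scale_pos,
    (R.limit_growthRate (8 * cF τ C ^ 2 / ε ^ 2 * (2 * S₂))).eventually_le_const (half_pos hδ)]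
    with n hρ hlarge ha hsmall
  have hρ0 := growthRate_nonneg (n := n) R.two_lt R.lt_three R.const_pos (π n)
  set A : Set (Fin n) := {v | (v : ℕ) < K}
  set a := (n : ℝ) ^ alpha τ * (π n : ℝ) with ha_def
  have ht : 0 < (ε * a) ^ 2 / 8 := by positivity
  have h1 := law_le_sum_indicator_le (w := vertexWeight τ C n) (p := π n)
    (c := fun _ : Fin n × Fin n => 1) (fun _ => zero_le_one)
    (fun q => {ω | LongPath (percGraph ω) A q.1 q.2}) ht
  have h2 := sum_sum_law_longPath_le hρ0 hρ testFun_pos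
    (sum_adjProb_mul_testFun_le R.two_lt R.lt_three R.const_pos (π n))
    (vertexWeight_nonneg R.two_lt R.const_pos) (b := cF τ C * (n : ℝ) ^ alpha τ) (by positivity)
    (vertexWeight_le R.two_lt R.lt_three R.const_pos) A
  refine (measureReal_mono ?_).trans (h1.trans ?_)
  · rintro ω ⟨x, hx, hω⟩
    have hcomp := sq_card_le_card_longPath (G := percGraph ω) (A := A) x
      fun v hv => not_lt.2 (hx v hv)
    have hcount : ∑ q : Fin n × Fin n, 1 * {ω | LongPath (percGraph ω) A q.1 q.2}.indicator
        (1 : Config n → ℝ) ω =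
        ((Finset.univ.filter
          fun q : Fin n × Fin n => LongPath (percGraph ω) A q.1 q.2).card : ℝ) := by
      rw [Finset.card_filter]
      push_cast
      exact Finset.sum_congr rfl fun q _ => by simp [Set.indicator_apply]
    have hcomp' : ((component (percGraph ω) x).card : ℝ) ^ 2 ≤
        4 * ((Finset.univ.filter
          fun q : Fin n × Fin n => LongPath (percGraph ω) A q.1 q.2).card : ℝ)
          + 4 * ((component (percGraph ω) x).card : ℝ) := by exact_mod_cast hcomp
    change (ε * a) ^ 2 / 8 ≤ _
    rw [hcount]
    have h8 : 8 ≤ ε * a := by rw [div_le_iff₀ hε] at hlarge; linarith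
    nlinarith
  · simp only [one_mul]
    rw [Fintype.sum_prod_type, div_le_iff₀ ht]
    refine h2.trans ?_
    have h3 := sum_sq_vertexWeight_le (n := n) R.two_lt R.lt_three R.const_pos K
    have h4 := sum_vertexWeight_mul_testFun_le (n := n) R.two_lt R.lt_three R.const_pos
    calc _ ≤ (π n : ℝ) ^ 2 * ((cF τ C * (n : ℝ) ^ alpha τ) ^ 2 *
            (S₁ * ((K : ℝ) + 1) ^ (1 - 2 * alpha τ)) +
          2 * growthRate τ C n (π n) * (cF τ C * (n : ℝ) ^ alpha τ) *
            (cF τ C * (n : ℝ) ^ alpha τ * S₂)) := by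
          gcongr
          exact le_trans (le_of_eq (Finset.sum_congr rfl fun z _ => by congr)) h3
      _ = (8 * cF τ C ^ 2 / ε ^ 2 * (S₁ * ((K : ℝ) + 1) ^ (1 - 2 * alpha τ)) +
          8 * cF τ C ^ 2 / ε ^ 2 * (2 * S₂) * growthRate τ C n (π n)) * ((ε * a) ^ 2 / 8) := by
          rw [ha_def]; field_simp
      _ ≤ δ * ((ε * a) ^ 2 / 8) := by gcongr; linarith

/-! ### The ordering of the components -/

/-- Components of hubs are strictly ordered by the labels of the hubs, because the limits
`c_F i^{-α}` of their rescaled sizes are distinct. -/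
theorem negligible_size_le {j k : ℕ} (hj : 1 ≤ j) (hjk : j < k) :
    Negligible (percLaw τ C π) fun n => {ω | ∃ x y : Fin n, (x : ℕ) + 1 = j ∧ (y : ℕ) + 1 = k ∧
      (component (percGraph ω) x).card ≤ (component (percGraph ω) y).card} := by
  have hc := cF_pos (τ := τ) R.const_pos
  have hα := half_lt_alpha R.two_lt R.lt_three
  have hgap : 0 < (cF τ C * (j : ℝ) ^ (-alpha τ) - cF τ C * (k : ℝ) ^ (-alpha τ)) / 2 := by
    have : (k : ℝ) ^ (-alpha τ) < (j : ℝ) ^ (-alpha τ) :=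
      Real.rpow_lt_rpow_of_neg (by exact_mod_cast hj) (by exact_mod_cast hjk) (by linarith)
    have := mul_lt_mul_of_pos_left this hc
    linarith
  refine ((R.negligible_size hj hgap).union
    (R.negligible_size (hj.trans hjk.le) hgap)).mono (Eventually.of_forall fun n => ?_)
  rintro ω ⟨x, y, hx, hy, hle⟩
  by_contra hcon
  simp only [Set.mem_union, Set.mem_ofPred_eq, not_or, not_exists, not_and, not_le] at hcon
  have h1 := abs_lt.1 (hcon.1 x hx)
  have h2 := abs_lt.1 (hcon.2 y hy)
  have h3 : ((component (percGraph ω) x).card : ℝ) ≤ (component (percGraph ω) y).card := by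
    exact_mod_cast hle
  linarith

/-- With high probability the `i`-th largest component is that of the vertex with label `i`. -/
theorem negligible_cluster_ne (r : ∀ (n : ℕ) (ω : Config n), ComponentOrder (percGraph ω))
    {i : ℕ} (hi : 1 ≤ i) :
    Negligible (percLaw τ C π) fun n => {ω | ¬ ∃ x : Fin n, (x : ℕ) + 1 = i ∧
      (r n ω).cluster i = component (percGraph ω) x} := by
  have hc := cF_pos (τ := τ) R.const_pos
  have hi0 : (0 : ℝ) < i := by exact_mod_cast hi
  have hci : 0 < cF τ C * (i : ℝ) ^ (-alpha τ) / 2 := by positivity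
  rw [Negligible, Metric.tendsto_atTop']
  intro δ hδ
  obtain ⟨K, hK⟩ := R.exists_small_components hci (half_pos hδ)
  -- two of the first `i` vertices are connected
  set E₁ : ∀ n, Set (Config n) := fun n => ⋃ q ∈ (Finset.range (i + 1) ×ˢ
    Finset.range (i + 1)).filter (fun q : ℕ × ℕ => 1 ≤ q.1 ∧ q.1 ≠ q.2),
    {ω | ∃ x : Fin n, (x : ℕ) + 1 = q.1 ∧
      ω ∈ {ω | ∃ y : Fin n, (y : ℕ) + 1 = q.2 ∧ (percGraph ω).Reachable x y}} with hE₁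
  -- the components of the first `i + K` vertices are not in strictly decreasing order of size
  set E₂ : ∀ n, Set (Config n) := fun n => ⋃ q ∈ (Finset.range (i + K + 1) ×ˢ
    Finset.range (i + K + 1)).filter (fun q : ℕ × ℕ => 1 ≤ q.1 ∧ q.1 < q.2),
      {ω | ∃ x y : Fin n, (x : ℕ) + 1 = q.1 ∧ (y : ℕ) + 1 = q.2 ∧
        (component (percGraph ω) x).card ≤ (component (percGraph ω) y).card} with hE₂
  -- the size of the component of the `i`-th vertex deviates by half of its limit or more
  set E₃ : ∀ n, Set (Config n) := fun n => {ω | ∃ x : Fin n, (x : ℕ) + 1 = i ∧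
      cF τ C * (i : ℝ) ^ (-alpha τ) / 2 * ((n : ℝ) ^ alpha τ * π n) ≤
        |((component (percGraph ω) x).card : ℝ) -
          cF τ C * (i : ℝ) ^ (-alpha τ) * ((n : ℝ) ^ alpha τ * π n)|} with hE₃
  have hneg : Negligible (percLaw τ C π) fun n => (E₁ n ∪ E₂ n) ∪ E₃ n := by
    refine (Negligible.union (Negligible.biUnion _ fun q hq => ?_)
      (Negligible.biUnion _ fun q hq => ?_)).union (R.negligible_size hi hci)
    · rw [Finset.mem_filter] at hq
      exact R.negligible_reachable hq.2.1 hq.2.2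
    · rw [Finset.mem_filter] at hq
      exact R.negligible_size_le hq.2.1 hq.2.2
  have hev := hK.and ((hneg.eventually_lt_const (half_pos hδ)).and (eventually_gt_atTop i))
  obtain ⟨N, hN⟩ := eventually_atTop.1 hev
  refine ⟨N, fun n hn => ?_⟩
  obtain ⟨hn1, hn2, hni⟩ := hN n hn.le
  rw [Real.dist_eq, sub_zero, abs_of_nonneg measureReal_nonneg]
  refine lt_of_le_of_lt ((measureReal_mono ?_).trans (measureReal_union_le _ _))
    (lt_of_lt_of_le (add_lt_add_of_lt_of_le hn2 hn1) (by linarith))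
  intro ω hω
  by_contra hcon
  rw [Set.mem_union, Set.mem_union, Set.mem_union, not_or, not_or, not_or] at hcon
  obtain ⟨⟨⟨h₁, h₂⟩, h₃⟩, h₄⟩ := hcon
  refine hω ⟨⟨i - 1, by omega⟩, by simp; omega, ?_⟩
  have hdist : ∀ x y : Fin n, (x : ℕ) < i → (y : ℕ) < i → x ≠ y →
      ¬ (percGraph ω).Reachable x y := by
    intro x y hx hy hxy hr
    refine h₁ (Set.mem_biUnion (x := ((x : ℕ) + 1, (y : ℕ) + 1)) ?_ ⟨x, rfl, y, rfl, hr⟩)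
    have : (x : ℕ) ≠ y := fun h => hxy (Fin.ext h)
    simp only [Finset.coe_filter, Finset.mem_product, Finset.mem_range, Set.mem_ofPred_eq]
    omega
  have hlt : ∀ x y : Fin n, (x : ℕ) < y → (y : ℕ) < i + K →
      (component (percGraph ω) y).card < (component (percGraph ω) x).card := by
    intro x y hxy hy
    by_contra hle
    refine h₂ (Set.mem_biUnion (x := ((x : ℕ) + 1, (y : ℕ) + 1)) ?_
      ⟨x, y, rfl, rfl, not_lt.1 hle⟩)
    simp only [Finset.coe_filter, Finset.mem_product, Finset.mem_range, Set.mem_ofPred_eq]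
    omega
  have hsize : cF τ C * (i : ℝ) ^ (-alpha τ) / 2 * ((n : ℝ) ^ alpha τ * π n) <
      (component (percGraph ω) ⟨i - 1, by omega⟩).card := by
    by_contra hle
    refine h₃ ⟨⟨i - 1, by omega⟩, by simp; omega, le_abs.2 (Or.inr ?_)⟩
    linarith
  refine cluster_eq_component (r n ω) (fun a => ⟨a, by omega⟩) hi ?_ ?_ ?_
  · intro a b hab
    exact hdist _ _ a.isLt b.isLt fun h => hab (Fin.ext (by simpa using h))
  · intro a ha
    exact hlt _ _ (by simp; omega) (by simp; omega)
  · intro x hx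
    by_cases hv : ∃ v, (percGraph ω).Reachable x v ∧ (v : ℕ) < K
    · obtain ⟨v, hxv, hvK⟩ := hv
      rw [component_eq_of_reachable hxv]
      have hiv : i ≤ (v : ℕ) := by
        by_contra hvi
        exact hx ⟨v, by omega⟩ hxv.symm
      exact hlt _ _ (by simp; omega) (by omega)
    · push Not at hv
      have : ((component (percGraph ω) x).card : ℝ) <
          (component (percGraph ω) ⟨i - 1, by omega⟩).card := by
        by_contra hle
        exact h₄ ⟨x, hv, by linarith⟩
      exact_mod_cast this

end Regime

end NorrosReittu

namespace NorrosReittu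

/-! ### Convergence of the ordered components -/

theorem regime_of_tendsto {τ C : ℝ} (hτ2 : 2 < τ) (hτ3 : τ < 3) (hC : 0 < C) {lam : ℕ → ℝ}
    {π : ℕ → unitInterval}
    (hπ : ∀ᶠ n : ℕ in atTop, (π n : ℝ) = lam n * (n : ℝ) ^ (-((3 - τ) / 2)))
    (hlam : Tendsto lam atTop (𝓝 0))
    (hlow : (fun n : ℕ => (n : ℝ) ^ (-alpha τ)) =o[atTop] fun n : ℕ => (π n : ℝ)) :
    Regime τ C π where
  two_lt := hτ2
  lt_three := hτ3
  const_pos := hC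
  growthRate_tendsto := by
    have h := hlam.mul_const ((2 + 2 ^ (alpha τ + 1 / 2) / (alpha τ + 1 / 2 - 1)) *
        cF τ C ^ (1 / (2 * alpha τ)))
    rw [zero_mul] at h
    refine h.congr' ?_
    filter_upwards [hπ, eventually_gt_atTop 0] with n hn hn0
    rw [hn, growthRate_eq hτ2 hC _ hn0]
  scale_tendsto := by
    rw [tendsto_atTop]
    intro b
    have hb : 0 < (max b 1)⁻¹ := inv_pos.2 (lt_of_lt_of_le one_pos (le_max_right _ _))
    filter_upwards [hlow.def hb, eventually_gt_atTop 0] with n hn hn0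
    have hn' : (0 : ℝ) < n := by exact_mod_cast hn0
    have hnα : (0 : ℝ) < (n : ℝ) ^ alpha τ := by positivity
    rw [Real.norm_of_nonneg (by positivity), Real.norm_of_nonneg (π n).2.1, inv_mul_eq_div,
      le_div_iff₀ (inv_pos.1 hb), Real.rpow_neg hn'.le, inv_mul_le_iff₀ hnα] at hn
    exact (le_max_left _ _).trans hn

end NorrosReittu

open NorrosReittu in
theorem theorem2p1
    (τ : ℝ) (hτ2 : 2 < τ) (hτ3 : τ < 3) (C : ℝ) (hC : 0 < C)
    (lam : ℕ → ℝ) (π : ℕ → unitInterval)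
    (hπ : ∀ᶠ n : ℕ in atTop, (π n : ℝ) = lam n * (n : ℝ) ^ (-((3 - τ) / 2)))
    (hlam : Tendsto lam atTop (𝓝 0))
    (hlow : (fun n : ℕ => (n : ℝ) ^ (-alpha τ)) =o[atTop] fun n : ℕ => (π n : ℝ))
    (r : ∀ (n : ℕ) (ω : Config n), ComponentOrder (percGraph ω))
    (P : ∀ n : ℕ, Measure (Config n))
    (hP : ∀ n : ℕ, P n = law (fun v : Fin n => weight τ C n (v + 1)) (π n))
    (i : ℕ) (hi : 1 ≤ i) :
    -- sizes of the ordered clusters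
    TendstoInProb P
      (fun n ω => (((r n ω).cluster i).card : ℝ) / ((n : ℝ) ^ alpha τ * π n))
      (cF τ C * (i : ℝ) ^ (-alpha τ)) ∧
    -- weights of the ordered clusters
    TendstoInProb P
      (fun n ω => (∑ v ∈ (r n ω).cluster i, weight τ C n (v + 1)) / (n : ℝ) ^ alpha τ)
      (cF τ C * (i : ℝ) ^ (-alpha τ)) ∧
    -- the `i`-th largest cluster is the one of the hub with label `i`
    WHP P (fun n => {ω | ∃ h : Fin n, (h : ℕ) + 1 = i ∧ h ∈ (r n ω).cluster i}) ∧
    -- all but a negligible part of it consists of this hub and its neighbours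
    TendstoInProb P
      (fun n ω => (({v : Fin n | v ∈ (r n ω).cluster i ∧ ∀ h : Fin n, (h : ℕ) + 1 = i →
          v ≠ h ∧ ¬ (percGraph ω).Adj h v}.ncard : ℕ) : ℝ) / ((n : ℝ) ^ alpha τ * π n))
      0 ∧
    -- different hubs lie in different components
    (∀ j : ℕ, 1 ≤ j → j ≠ i →
      WHP P (fun n => {ω | ∃ h k : Fin n, (h : ℕ) + 1 = i ∧ (k : ℕ) + 1 = j ∧
        ¬ (percGraph ω).Reachable h k})) := by
  classical
  have R := regime_of_tendsto hτ2 hτ3 hC hπ hlam hlow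
  obtain rfl : P = percLaw τ C π := funext hP
  have hne := R.negligible_cluster_ne r hi
  refine ⟨?_, ?_, ?_, ?_, ?_⟩
  · refine Negligible.tendstoInProb fun ε hε =>
      (hne.union (R.negligible_size hi hε)).mono ?_
    filter_upwards [R.eventually_scale_pos] with n ha ω hω
    by_cases hx : ∃ x : Fin n, (x : ℕ) + 1 = i ∧ (r n ω).cluster i = component (percGraph ω) x
    · obtain ⟨x, hxi, hx⟩ := hx
      refine Or.inr ⟨x, hxi, ?_⟩
      simp only [Set.mem_ofPred_eq] at hω
      rwa [hx, div_sub' ha.ne', abs_div, abs_of_pos ha, le_div_iff₀ ha, mul_comm _ (cF τ C * _)]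
        at hω
    · exact Or.inl hx
  · refine Negligible.tendstoInProb fun ε hε =>
      (hne.union (R.negligible_weight hi hε)).mono ?_
    filter_upwards [eventually_gt_atTop 0] with n hn ω hω
    have hn' : (0 : ℝ) < n := by exact_mod_cast hn
    have hnα : (0 : ℝ) < (n : ℝ) ^ alpha τ := by positivity
    by_cases hx : ∃ x : Fin n, (x : ℕ) + 1 = i ∧ (r n ω).cluster i = component (percGraph ω) x
    · obtain ⟨x, hxi, hx⟩ := hx
      refine Or.inr ⟨x, hxi, ?_⟩
      simp only [Set.mem_ofPred_eq] at hω ⊢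
      have hwx : weight τ C n (x + 1) = cF τ C * (i : ℝ) ^ (-alpha τ) * (n : ℝ) ^ alpha τ := by
        have := vertexWeight_eq hτ2 hC x
        rw [vertexWeight] at this
        rw [this, ← hxi]; push_cast; ring
      have hrest : 0 ≤ ∑ y ∈ (component (percGraph ω) x).erase x, vertexWeight τ C n y :=
        Finset.sum_nonneg fun y _ => vertexWeight_nonneg hτ2 hC y
      rw [hx, ← Finset.sum_erase_add _ _ (mem_component.2 (SimpleGraph.Reachable.refl x)), hwx,
        add_div, mul_div_cancel_right₀ _ hnα.ne', add_sub_cancel_right] at hω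
      simp only [vertexWeight] at hrest ⊢
      rwa [abs_of_nonneg (div_nonneg hrest hnα.le), le_div_iff₀ hnα] at hω
    · exact Or.inl hx
  · refine Negligible.whp (hne.mono (Eventually.of_forall fun n ω hω => ?_))
    rintro ⟨x, hxi, hx⟩
    exact hω ⟨x, hxi, hx ▸ mem_component.2 (SimpleGraph.Reachable.refl x)⟩
  · refine Negligible.tendstoInProb fun ε hε =>
      (hne.union (R.negligible_longPath hi hε)).mono ?_
    filter_upwards [R.eventually_scale_pos] with n ha ω hω
    by_cases hx : ∃ x : Fin n, (x : ℕ) + 1 = i ∧ (r n ω).cluster i = component (percGraph ω) x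
    · obtain ⟨x, hxi, hx⟩ := hx
      refine Or.inr ⟨x, hxi, ?_⟩
      simp only [Set.mem_ofPred_eq] at hω ⊢
      rw [sub_zero, abs_of_nonneg (by positivity), le_div_iff₀ ha] at hω
      refine hω.trans ?_
      rw [← Set.ncard_coe_finset]
      refine Nat.cast_le.2 (Set.ncard_le_ncard ?_ (Set.toFinite _))
      rintro v ⟨hv, hv'⟩
      obtain ⟨hvx, hadj⟩ := hv' x hxi
      rw [hx, mem_component] at hv
      simpa using longPath_of_reachable (A := ∅) hv (by simp) hvx.symm hadj
    · exact Or.inl hx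
  · intro j hj hji
    refine Negligible.whp ((R.negligible_reachable hi hji.symm).mono ?_)
    filter_upwards [eventually_ge_atTop i, eventually_ge_atTop j] with n hin hjn ω hω
    have hx : i - 1 < n := by omega
    have hy : j - 1 < n := by omega
    refine ⟨⟨i - 1, hx⟩, Nat.sub_add_cancel hi, ⟨j - 1, hy⟩, Nat.sub_add_cancel hj, ?_⟩
    by_contra hr
    exact hω ⟨⟨i - 1, hx⟩, ⟨j - 1, hy⟩, Nat.sub_add_cancel hi, Nat.sub_add_cancel hj, hr⟩
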